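/- Fix a universe; all categories below are small in it, $\mathbf{Cat}$ is the 2-category of these categories, and $I$ is a set, regarded also as a discrete category. **Operads.** A (coloured, symmetric) operad $T$ with set of colours $I$ has sets of arrows $\alpha:(i_1,\dots,i_n)\to i$ ($n\ge 0$, $i_j,i\in I$); arrows $\alpha\rho:(i_{\rho 1},\dots,i_{\rho n})\to i$ for $\rho\in\Sigma_n$, with $\alpha 1=\alpha$ and $(\alpha\rho_1)\rho_2=\alpha(\rho_1\rho_2)$; unit arrows $1_i:(i)\to i$; and, for $\alpha:(i_j)_{1\le j\le n}\to i$ and $\beta_j:(i_{jk})_{1\le k\le m_j}\to i_j$, composites $\alpha(\beta_j)_j:(i_{jk})_{jk}\to i$, where $(i_{jk})_{jk}$ is the concatenation. Composition is associative and unital and satisfies $(\alpha(\beta_j)_j)(\rho(\rho_j)_j)=(\alpha\rho)(\beta_{\rho j}\rho_j)_j$, where $\rho(\rho_j)_j$ is the permutation of the concatenation sending the position $(j,k)$ to $(\rho j,\rho_j k)$. **The 2-monad.** Let $B_T$ be the category whose objects are the arrows of $T$ and whose morphisms $\alpha\to\beta$ are the permutations $\rho$ with $\alpha=\beta\rho$;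 let $E_T$ be the category of pairs $(\alpha,j)$ with $\alpha:(i_1,\dots,i_n)\to i$ in $T$ and $1\le j\le n$, whose morphisms $(\alpha,j)\to(\beta,k)$ are the $\rho:\alpha\to\beta$ in $B_T$ with $\rho j=k$; and let $I\xleftarrow{s}E_T\xrightarrow{p}B_T\xrightarrow{t}I$ be given by $s(\alpha,j)=i_j$, $p(\alpha,j)=\alpha$, $t(\alpha)=i$. The 2-monad on $\mathbf{Cat}/I$ of the operad $T$, also denoted $T$, has as its underlying 2-functor the polynomial functor $\Sigma_t\Pi_p\Delta_s$ of this diagram. Explicitly, for $X\to I$ in $\mathbf{Cat}/I$ with fibres $X_i$, an object of $TX$ is a pair $(\alpha,(x_j)_j)$ with $\alpha:(i_j)_j\to i$ in $T$ and $x_j\in X_{i_j}$, lying over $i$; a morphism $(\alpha,(x_j)_j)\to(\beta,(y_j)_j)$ is a permutation $\rho$ with $\alpha=\beta\rho$ together with morphisms $x_j\to y_{\rho j}$ of $X$; and $T$ acts on functors and natural transformations over $I$ labelwise. The unit is $\eta(x)=(1_i,(x))$ for $x\in X_i$, and on a morphism $f$ of $X$ it is $(1,(f))$. The multiplication is $\mu(\alpha,(\alpha_j,(x_{jk})_k)_j)=(\alpha(\alpha_j)_j,(x_{jk})_{jk})$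 and, on morphisms, $\mu(\rho,(\rho_j,(f_{jk})_k)_j)=(\rho(\rho_j)_j,(f_{jk})_{jk})$. A *lax $T$-algebra structure* on $H\to I$ consists of $a:TH\to H$ in $\mathbf{Cat}/I$ and 2-cells $\bar a_0:1_H\to a\eta_H$ and $\bar a_2:a\,T(a)\to a\mu_H$ such that $$(\bar a_2\,\eta_{TH})(\bar a_0\,a)=\mathrm{id}_a,\qquad (\bar a_2\,T(\eta_H))(a\,T(\bar a_0))=\mathrm{id}_a,$$ $$(\bar a_2\,\mu_{TH})(\bar a_2\,T^2(a))=(\bar a_2\,T(\mu_H))(a\,T(\bar a_2)).$$ It is *pseudo* if $\bar a_0,\bar a_2$ are invertible and *strict* if they are identities. **Morphisms into $\underline{\mathbf{Cat}}$.** Let $H_i$ ($i\in I$) be categories. The structure of a *lax morphism of operads* $T\to\underline{\mathbf{Cat}}$ on $(H_i)_i$ consists of * products: functors $H_\alpha:\prod_j H_{i_j}\to H_i$ for all $\alpha:(i_j)_j\to i$ in $T$; * symmetries: natural transformations $\xi_{\alpha,\rho}:H_{\alpha\rho}c_\rho\to H_\alpha$, where $c_\rho:\prod_j H_{i_j}\cong\prod_j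 H_{i_{\rho j}}$ permutes the factors; * units: natural transformations $\nu_i:1_{H_i}\to H_{1_i}$; * substitutions: natural transformations $\sigma_{\alpha,(\beta_j)_j}:H_\alpha\bigl(\prod_j H_{\beta_j}\bigr)\to H_{\alpha(\beta_j)_j}$; such that the following hold. Here iterated products are identified with products over concatenated index sequences, and $x_j$, $x_{jk}$, $x_{jkl}$ are arbitrary objects of the appropriate $H_i$. 1. $\xi_{\alpha,1}=\mathrm{id}$ and $\xi_{\alpha,\rho_1\rho_2}=\xi_{\alpha,\rho_1}(\xi_{\alpha\rho_1,\rho_2}c_{\rho_1})$. 2. $\sigma_{\alpha,(1_{i_j})_j}\circ H_\alpha(\nu_{i_j})_j=\mathrm{id}_{H_\alpha}$ and $\sigma_{1_i,(\alpha)}\circ\nu_iH_\alpha=\mathrm{id}_{H_\alpha}$. 3. The two morphisms $H_{\alpha\rho}\bigl(H_{\beta_{\rho j}\rho_j}(x_{\rho j,\rho_j k})_k\bigr)_j\to H_{\alpha(\beta_j)_j}(x_{jk})_{jk}$ agree, one being $H_{\alpha\rho}(\xi_{\beta_{\rho j},\rho_j})_j$ followed by $\xi_{\alpha,\rho}$ and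 then by $\sigma_{\alpha,(\beta_j)_j}$, the other being $\sigma_{\alpha\rho,(\beta_{\rho j}\rho_j)_j}$ followed by $\xi_{\alpha(\beta_j)_j,\rho(\rho_j)_j}$. 4. The two morphisms $H_\alpha\bigl(H_{\beta_j}(H_{\gamma_{jk}}(x_{jkl})_l)_k\bigr)_j\to H_{\alpha(\beta_j(\gamma_{jk})_k)_j}(x_{jkl})_{jkl}$ agree, one being $\sigma_{\alpha,(\beta_j)_j}$ followed by $\sigma_{\alpha(\beta_j)_j,(\gamma_{jk})_{jk}}$, the other being $H_\alpha(\sigma_{\beta_j,(\gamma_{jk})_k})_j$ followed by $\sigma_{\alpha,(\beta_j(\gamma_{jk})_k)_j}$. It is a *pseudo morphism* if all $\nu_i$ and $\sigma_{\alpha,(\beta_j)_j}$ are invertible and a *strict morphism* if they are all identities. **Theorem.** Let $T$ be an operad with set of colours $I$ and let $H\to I$ be an object of $\mathbf{Cat}/I$ with fibres $(H_i)_{i\in I}$. Then there is a bijection between lax $T$-algebra structures $(a,\bar a_0,\bar a_2)$ on $H\to I$ and structures of a lax morphism of operads $T\to\underline{\mathbf{Cat}}$ on $(H_i)_{i\in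 I}$, under which $$H_\alpha(x_j)_j=a(\alpha,(x_j)_j),\qquad H_\alpha(f_j)_j=a(1,(f_j)_j),\qquad (\xi_{\alpha,\rho})_{(x_j)_j}=a(\rho,(1_{x_{\rho j}})_j),$$ $$(\nu_i)_x=(\bar a_0)_x,\qquad (\sigma_{\alpha,(\beta_j)_j})_{(x_{jk})_{jk}}=(\bar a_2)_{(\alpha,(\beta_j,(x_{jk})_k)_j)}.$$ A lax $T$-algebra structure is pseudo if and only if the corresponding lax morphism is a pseudo morphism, and strict if and only if it is a strict morphism. -/

import Mathlib

open CategoryTheory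

universe u

namespace PolyOperad

/-! ### Positions in concatenated sequences -/

section Positions

/-- The block-and-offset coordinates `(j, k)` of a position in a concatenation of `n` blocks of
lengths `m 0, ..., m (n - 1)`. -/
abbrev pos {n : ℕ} {m : Fin n → ℕ} (t : Fin (∑ j, m j)) : (j : Fin n) × Fin (m j) :=
  finSigmaFinEquiv.symm t

/-- The concatenation of a sequence of sequences. -/
abbrev concat {n : ℕ} {m : Fin n → ℕ} {A : Type*} (d : ∀ j, Fin (m j) → A) :
    Fin (∑ j, m j) → A :=
  fun t => d (pos t).1 (pos t).2

theorem concat_mk {n : ℕ} {m : Fin n → ℕ} {A : Type*} (d : ∀ j, Fin (m j) → A)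
    (s : (j : Fin n) × Fin (m j)) : concat d (finSigmaFinEquiv s) = d s.1 s.2 :=
  congrArg (fun s : (j : Fin n) × Fin (m j) => d s.1 s.2) (finSigmaFinEquiv.symm_apply_apply s)

/-- The permutation `ρ(ρ_j)_j` of a concatenation: the blocks are permuted by `ρ` and the inside
of the blocks by the `ρ_j`; so it sends the position `(j, k)` to `(ρ j, ρ_j k)`. -/
def blockPerm {n n' : ℕ} {m' : Fin n' → ℕ} {m : Fin n → ℕ} (ρ : Fin n' ≃ Fin n)
    (ρs : ∀ j, Fin (m' j) ≃ Fin (m (ρ j))) : Fin (∑ j, m' j) ≃ Fin (∑ j, m j) :=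
  finSigmaFinEquiv.symm.trans ((Equiv.sigmaCongr ρ ρs).trans finSigmaFinEquiv)

theorem pos_blockPerm {n n' : ℕ} {m' : Fin n' → ℕ} {m : Fin n → ℕ} (ρ : Fin n' ≃ Fin n)
    (ρs : ∀ j, Fin (m' j) ≃ Fin (m (ρ j))) (t : Fin (∑ j, m' j)) :
    pos (blockPerm ρ ρs t) = ⟨ρ (pos t).1, ρs _ (pos t).2⟩ := by
  simp [pos, blockPerm, Equiv.sigmaCongr]

theorem pos_injective {n : ℕ} {m : Fin n → ℕ} : Function.Injective (pos (m := m)) :=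
  finSigmaFinEquiv.symm.injective

theorem blockPerm_refl {n : ℕ} {m : Fin n → ℕ} (t : Fin (∑ j, m j)) :
    blockPerm (m' := m) (Equiv.refl _) (fun j => Equiv.refl (Fin (m j))) t = t :=
  pos_injective (pos_blockPerm _ _ t)

theorem blockPerm_trans {n n' n'' : ℕ} {m'' : Fin n'' → ℕ} {m' : Fin n' → ℕ} {m : Fin n → ℕ}
    (τ : Fin n'' ≃ Fin n') (τs : ∀ j, Fin (m'' j) ≃ Fin (m' (τ j))) (ρ : Fin n' ≃ Fin n)
    (ρs : ∀ j, Fin (m' j) ≃ Fin (m (ρ j))) (t : Fin (∑ j, m'' j)) :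
    blockPerm (m := m) (τ.trans ρ) (fun j => (τs j).trans (ρs (τ j))) t =
      blockPerm ρ ρs (blockPerm τ τs t) := by
  apply pos_injective
  rw [pos_blockPerm, pos_blockPerm]
  exact (congrArg (fun q : (j : Fin n') × Fin (m' j) =>
    (⟨ρ q.1, ρs q.1 q.2⟩ : (j : Fin n) × Fin (m j))) (pos_blockPerm τ τs t)).symm

/-- The number of the position `(j, k)` in a concatenation. -/
theorem val_mk {n : ℕ} {m : Fin n → ℕ} (j : Fin n) (k : Fin (m j)) :
    (finSigmaFinEquiv ⟨j, k⟩ : ℕ) = (∑ i, if i < j then m i else 0) + k := by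
  rw [finSigmaFinEquiv_apply]
  congr 1
  rw [← Finset.sum_filter]
  refine Finset.sum_bij (fun i _ => Fin.castLE j.2.le i) ?_ ?_ ?_ ?_
  · intro i _
    simp only [Finset.mem_filter, Finset.mem_univ, true_and]
    exact i.2
  · intro a _ b _ h
    simpa using h
  · intro b hb
    simp only [Finset.mem_filter, Finset.mem_univ, true_and] at hb
    exact ⟨⟨b, hb⟩, Finset.mem_univ _, rfl⟩
  · intro _ _
    rfl

theorem mk_lt {n : ℕ} {m : Fin n → ℕ} (j' j : Fin n) (k' : Fin (m j')) (k : Fin (m j))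
    (h : j' < j) :
    (finSigmaFinEquiv ⟨j', k'⟩ : Fin (∑ j, m j)) < finSigmaFinEquiv ⟨j, k⟩ := by
  rw [Fin.lt_def, val_mk, val_mk]
  have h1 : (∑ i, if i < j' then m i else 0) + m j' ≤ ∑ i, if i < j then m i else 0 := by
    rw [← Finset.sum_filter, ← Finset.sum_filter]
    have h2 : m j' = ∑ i ∈ {j'}, m i := by simp
    rw [h2, ← Finset.sum_union (by simp)]
    apply Finset.sum_le_sum_of_subset
    intro i hi
    simp only [Finset.mem_union, Finset.mem_filter, Finset.mem_univ, true_and,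
      Finset.mem_singleton] at hi ⊢
    rcases hi with hi | hi
    · exact hi.trans h
    · exact hi ▸ h
  have := k'.2
  omega

/-- Positions in an iterated concatenation do not depend on the bracketing. -/
theorem val_assoc {n : ℕ} {m : Fin n → ℕ} {p : ∀ j, Fin (m j) → ℕ} (j : Fin n) (k : Fin (m j))
    (l : Fin (p j k)) (l' : Fin (concat p (finSigmaFinEquiv ⟨j, k⟩))) (hl : (l : ℕ) = l') :
    (finSigmaFinEquiv (⟨finSigmaFinEquiv ⟨j, k⟩, l'⟩ : (t : Fin (∑ j, m j)) × Fin (concat p t)) : ℕ)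
      = finSigmaFinEquiv (⟨j, finSigmaFinEquiv ⟨k, l⟩⟩ : (j : Fin n) × Fin (∑ k, p j k)) := by
  rw [val_mk, val_mk, val_mk, ← hl, ← add_assoc]
  congr 1
  rw [← finSigmaFinEquiv.sum_comp, Fintype.sum_sigma]
  have key : ∀ i : Fin n, (∑ q : Fin (m i),
      if (finSigmaFinEquiv ⟨i, q⟩ : Fin (∑ j, m j)) < finSigmaFinEquiv ⟨j, k⟩
        then concat p (finSigmaFinEquiv ⟨i, q⟩) else 0)
      = (if i < j then ∑ q, p i q else 0) +
        (if i = j then ∑ q : Fin (m j), if q < k then p j q else 0 else 0) := by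
    intro i
    rcases lt_trichotomy i j with h | h | h
    · simp only [h, h.ne, mk_lt i j _ k h, if_true, if_false, add_zero]
      exact Finset.sum_congr rfl fun q _ => concat_mk p ⟨i, q⟩
    · subst h
      have h1 : ∀ q : Fin (m i), (finSigmaFinEquiv ⟨i, q⟩ : Fin (∑ j, m j)) <
          finSigmaFinEquiv ⟨i, k⟩ ↔ q < k := by
        intro q
        rw [Fin.lt_def, val_mk, val_mk, Nat.add_lt_add_iff_left, Fin.lt_def]
      simp only [h1, lt_irrefl, if_true, if_false, zero_add]
      exact Finset.sum_congr rfl fun q _ => by rw [concat_mk p ⟨i, q⟩]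
    · simp [h.ne', not_lt.2 h.le, not_lt.2 (mk_lt j i k _ h).le]
  rw [Finset.sum_congr rfl fun i _ => key i, Finset.sum_add_distrib]
  simp

theorem val_pos_assoc {n : ℕ} {m : Fin n → ℕ} {p : ∀ j, Fin (m j) → ℕ} (s : Fin (∑ j, m j))
    (l : Fin (concat p s)) :
    (finSigmaFinEquiv (⟨s, l⟩ : (t : Fin (∑ j, m j)) × Fin (concat p t)) : ℕ) =
      finSigmaFinEquiv (⟨(pos s).1, finSigmaFinEquiv ⟨(pos s).2, l⟩⟩ :
        (j : Fin n) × Fin (∑ k, p j k)) := by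
  have key : ∀ s' (_ : s' = s) (l' : Fin (concat p s')), (l : ℕ) = l' →
      (finSigmaFinEquiv (⟨s', l'⟩ : (t : Fin (∑ j, m j)) × Fin (concat p t)) : ℕ) =
        finSigmaFinEquiv (⟨s, l⟩ : (t : Fin (∑ j, m j)) × Fin (concat p t)) := by
    rintro _ rfl l' hl
    rw [Fin.ext hl]
  have hs : finSigmaFinEquiv ⟨(pos s).1, (pos s).2⟩ = s := finSigmaFinEquiv.apply_symm_apply s
  have hv := val_assoc (p := p) (pos s).1 (pos s).2 l
    (Fin.cast (congrArg (concat p) hs).symm l) rfl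
  rwa [key _ hs _ rfl] at hv

/-- The coordinates of a position in an iterated concatenation, for the first bracketing. -/
abbrev coordL {n : ℕ} {m : Fin n → ℕ} {p : ∀ j, Fin (m j) → ℕ} (t : Fin (∑ s, concat p s)) :
    (j : Fin n) × (k : Fin (m j)) × Fin (p j k) :=
  ⟨(pos (pos t).1).1, (pos (pos t).1).2, (pos t).2⟩

/-- The coordinates of a position in an iterated concatenation, for the second bracketing. -/
abbrev coordR {n : ℕ} {m : Fin n → ℕ} {p : ∀ j, Fin (m j) → ℕ} (t : Fin (∑ j, ∑ k, p j k)) :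
    (j : Fin n) × (k : Fin (m j)) × Fin (p j k) :=
  ⟨(pos t).1, (pos (pos t).2).1, (pos (pos t).2).2⟩

theorem coordR_mk {n : ℕ} {m : Fin n → ℕ} {p : ∀ j, Fin (m j) → ℕ}
    (q : (j : Fin n) × (k : Fin (m j)) × Fin (p j k)) :
    coordR (finSigmaFinEquiv (⟨q.1, finSigmaFinEquiv q.2⟩ : (j : Fin n) × Fin (∑ k, p j k))) =
      q := by
  obtain ⟨j, r⟩ := q
  have h2 : pos (finSigmaFinEquiv (⟨j, finSigmaFinEquiv r⟩ :
      (j : Fin n) × Fin (∑ k, p j k))) = ⟨j, finSigmaFinEquiv r⟩ :=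
    finSigmaFinEquiv.symm_apply_apply _
  have h3 : pos (finSigmaFinEquiv r) = r := finSigmaFinEquiv.symm_apply_apply _
  exact (congrArg (fun q : (j : Fin n) × Fin (∑ k, p j k) =>
      (⟨q.1, (pos q.2).1, (pos q.2).2⟩ : (j : Fin n) × (k : Fin (m j)) × Fin (p j k))) h2).trans
    (congrArg (fun q : (k : Fin (m j)) × Fin (p _ k) =>
      (⟨j, q.1, q.2⟩ : (j : Fin n) × (k : Fin (m j)) × Fin (p j k))) h3)

theorem val_eq_coordL {n : ℕ} {m : Fin n → ℕ} {p : ∀ j, Fin (m j) → ℕ}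
    (t : Fin (∑ s, concat p s)) :
    (t : ℕ) = finSigmaFinEquiv (⟨(coordL t).1, finSigmaFinEquiv (coordL t).2⟩ :
      (j : Fin n) × Fin (∑ k, p j k)) := by
  refine Eq.trans ?_ (val_pos_assoc (pos t).1 (pos t).2)
  exact congrArg Fin.val (finSigmaFinEquiv.apply_symm_apply t).symm

theorem pos_assoc {n : ℕ} {m : Fin n → ℕ} {p : ∀ j, Fin (m j) → ℕ}
    (t : Fin (∑ s, concat p s)) (t' : Fin (∑ j, ∑ k, p j k)) (h : (t : ℕ) = t') :
    coordL t = coordR t' := by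
  rw [← Fin.ext ((val_eq_coordL t).symm.trans h), coordR_mk]

theorem val_eq_of_coord {n : ℕ} {m : Fin n → ℕ} {p : ∀ j, Fin (m j) → ℕ}
    (t : Fin (∑ s, concat p s)) (t' : Fin (∑ j, ∑ k, p j k)) (h : coordL t = coordR t') :
    (t : ℕ) = t' := by
  rw [val_eq_coordL t, h]
  congr 1
  have h1 : finSigmaFinEquiv (⟨(pos (pos t').2).1, (pos (pos t').2).2⟩ :
      (k : Fin (m (pos t').1)) × Fin (p _ k)) = (pos t').2 :=
    finSigmaFinEquiv.apply_symm_apply _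
  exact (congrArg (fun r => finSigmaFinEquiv (⟨(pos t').1, r⟩ :
    (j : Fin n) × Fin (∑ k, p j k))) h1).trans (finSigmaFinEquiv.apply_symm_apply t')

theorem triple_ext {n : ℕ} {m : Fin n → ℕ} {p : ∀ j, Fin (m j) → ℕ}
    {q q' : (j : Fin n) × Fin (m j)} (h : q = q') (l : Fin (p q.1 q.2)) (l' : Fin (p q'.1 q'.2))
    (hl : (l : ℕ) = l') :
    (⟨q.1, q.2, l⟩ : (j : Fin n) × (k : Fin (m j)) × Fin (p j k)) = ⟨q'.1, q'.2, l'⟩ := by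
  subst h
  rw [Fin.ext hl]

theorem blockPerm_assoc {n n' : ℕ} {m' : Fin n' → ℕ} {m : Fin n → ℕ} {p' : ∀ j, Fin (m' j) → ℕ}
    {p : ∀ j, Fin (m j) → ℕ} (ρ : Fin n' ≃ Fin n) (σ : ∀ j, Fin (m' j) ≃ Fin (m (ρ j)))
    (θ : ∀ j k, Fin (p' j k) ≃ Fin (p (ρ j) (σ j k)))
    (θ' : ∀ s, Fin (concat p' s) ≃ Fin (concat p (blockPerm ρ σ s)))
    (hθ : ∀ s (l : Fin (concat p' s)), (θ' s l : ℕ) = θ (pos s).1 (pos s).2 l)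
    (t : Fin (∑ s, concat p' s)) (t' : Fin (∑ j, ∑ k, p' j k)) (h : (t : ℕ) = t') :
    (blockPerm (blockPerm ρ σ) θ' t : ℕ) =
      blockPerm (m := fun j => ∑ k, p j k) ρ (fun j => blockPerm (σ j) (θ j)) t' := by
  apply val_eq_of_coord
  have h0 := pos_assoc t t' h
  have h1 := pos_blockPerm (blockPerm ρ σ) θ' t
  have h2 := pos_blockPerm ρ σ (pos t).1
  have h3 := pos_blockPerm (m := fun j => ∑ k, p j k) ρ (fun j => blockPerm (σ j) (θ j)) t'
  have h4 := pos_blockPerm (σ (pos t').1) (θ (pos t').1) (pos t').2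
  have hL : coordL (p := p) (blockPerm (blockPerm ρ σ) θ' t) =
      ⟨ρ (coordL t).1, σ _ (coordL t).2.1, θ _ _ (coordL t).2.2⟩ := by
    refine triple_ext (q := pos (pos (blockPerm (blockPerm ρ σ) θ' t)).1)
      (q' := ⟨ρ (coordL t).1, σ _ (coordL t).2.1⟩) ?_ _ _ ?_
    · exact (congrArg (fun q : (s : Fin (∑ j, m j)) × Fin (concat p s) => pos q.1) h1).trans h2
    · exact (congrArg (fun q : (s : Fin (∑ j, m j)) × Fin (concat p s) => (q.2 : ℕ)) h1).trans
        (hθ _ _)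
  have hR : coordR (p := p) (blockPerm (m := fun j => ∑ k, p j k) ρ (fun j => blockPerm (σ j) (θ j)) t') =
      ⟨ρ (coordR t').1, σ _ (coordR t').2.1, θ _ _ (coordR t').2.2⟩ :=
    (congrArg (fun q : (j : Fin n) × Fin (∑ k, p j k) =>
      (⟨q.1, (pos q.2).1, (pos q.2).2⟩ : (j : Fin n) × (k : Fin (m j)) × Fin (p j k))) h3).trans
    (congrArg (fun q : (k : Fin (m (ρ (pos t').1))) × Fin (p _ k) =>
      (⟨ρ (pos t').1, q.1, q.2⟩ : (j : Fin n) × (k : Fin (m j)) × Fin (p j k))) h4)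
  rw [hL, hR, h0]

theorem pos_unit_right {n : ℕ} (t : Fin (∑ _j : Fin n, 1)) : ((pos t).1 : ℕ) = t := by
  obtain ⟨⟨j, k⟩, rfl⟩ := finSigmaFinEquiv.surjective t
  simp [pos]

theorem pos_unit_left {n : ℕ} (t : Fin (∑ _j : Fin 1, n)) : ((pos t).2 : ℕ) = t := by
  obtain ⟨⟨j, k⟩, rfl⟩ := finSigmaFinEquiv.surjective t
  rw [finSigmaFinEquiv_one]
  simp [pos]

theorem blockPerm_unit_left {n n' : ℕ} (σ : Fin n' ≃ Fin n) (t : Fin (∑ _j : Fin 1, n'))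
    (t' : Fin n') (h : (t : ℕ) = t') :
    (blockPerm (m := fun _ : Fin 1 => n) (Equiv.refl (Fin 1)) (fun _ => σ) t : ℕ) = σ t' := by
  rw [← pos_unit_left, pos_blockPerm]
  exact congrArg (fun k => (σ k : ℕ)) (Fin.ext ((pos_unit_left t).trans h))

theorem blockPerm_unit_right {n n' : ℕ} (σ : Fin n' ≃ Fin n) (t : Fin (∑ _j : Fin n', 1))
    (t' : Fin n') (h : (t : ℕ) = t') :
    (blockPerm (m := fun _ : Fin n => 1) σ (fun _ => Equiv.refl (Fin 1)) t : ℕ) = σ t' := by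
  rw [← pos_unit_right, pos_blockPerm]
  exact congrArg (fun k => (σ k : ℕ)) (Fin.ext ((pos_unit_right t).trans h))

end Positions

/-! ### Operads -/

/-- A (coloured, symmetric) collection with set of colours `I`: sets of arrows
`α : (c 0, ..., c (n - 1)) ⟶ i`, on which permutations act. A bijection `Fin m ≃ Fin n` exists
only if `m = n`, so `act` is the action of the symmetric groups; `αρ` has source `j ↦ c (ρ j)`. -/
structure Collection (I : Type u) where
  /-- The set of arrows with source the sequence `c` and target `i`. -/
  Op : {n : ℕ} → (c : Fin n → I) → (i : I) → Type u
  /-- The arrow `αρ`. -/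
  act : ∀ {m n : ℕ} {c : Fin n → I} {i : I}, Op c i → (ρ : Fin m ≃ Fin n) → Op (c ∘ ρ) i
  act_refl : ∀ {n : ℕ} {c : Fin n → I} {i : I} (α : Op c i), act α (Equiv.refl _) = α
  act_act : ∀ {l m n : ℕ} {c : Fin n → I} {i : I} (α : Op c i) (ρ : Fin m ≃ Fin n)
    (τ : Fin l ≃ Fin m), act (act α ρ) τ = act α (τ.trans ρ)

/-- An arrow of a collection together with its source and target. An equality in this type
says that two arrows have the same source and the same target and are equal. -/
structure Collection.Arrow {I : Type u} (T : Collection I) where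
  /-- The length of the source. -/
  arity : ℕ
  /-- The source. -/
  src : Fin arity → I
  /-- The target. -/
  tgt : I
  /-- The arrow itself. -/
  op : T.Op src tgt

/-- An arrow with its source and target. -/
abbrev Collection.arrow {I : Type u} (T : Collection I) {n : ℕ} {c : Fin n → I} {i : I}
    (α : T.Op c i) : T.Arrow := ⟨n, c, i, α⟩

/-- A (coloured, symmetric) operad with set of colours `I`. -/
structure Operad (I : Type u) extends Collection I where
  /-- The unit arrows. -/
  one : ∀ i : I, Op (fun _ : Fin 1 => i) i
  /-- The composite `α ∘ (β_j)_j`, whose source is the concatenation of the sources. -/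
  comp : ∀ {n : ℕ} {c : Fin n → I} {i : I} (_ : Op c i) {m : Fin n → ℕ}
    {d : ∀ j, Fin (m j) → I} (_ : ∀ j, Op (d j) (c j)), Op (concat d) i
  one_comp : ∀ {n : ℕ} {c : Fin n → I} {i : I} (α : Op c i),
    toCollection.arrow (comp (one i) fun _ => α) = toCollection.arrow α
  comp_one : ∀ {n : ℕ} {c : Fin n → I} {i : I} (α : Op c i),
    toCollection.arrow (comp α fun j => one (c j)) = toCollection.arrow α
  assoc : ∀ {n : ℕ} {c : Fin n → I} {i : I} (α : Op c i) {m : Fin n → ℕ}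
    {d : ∀ j, Fin (m j) → I} (β : ∀ j, Op (d j) (c j)) {p : ∀ j, Fin (m j) → ℕ}
    {e : ∀ j k, Fin (p j k) → I} (γ : ∀ j k, Op (e j k) (d j k)),
    toCollection.arrow (comp (comp α β) fun t => γ (pos t).1 (pos t).2) =
      toCollection.arrow (comp α fun j => comp (β j) (γ j))
  equivariance : ∀ {n n' : ℕ} {c : Fin n → I} {i : I} (α : Op c i) {m : Fin n → ℕ}
    {d : ∀ j, Fin (m j) → I} (β : ∀ j, Op (d j) (c j)) (ρ : Fin n' ≃ Fin n) {m' : Fin n' → ℕ}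
    (ρs : ∀ j, Fin (m' j) ≃ Fin (m (ρ j))),
    toCollection.arrow (act (comp α β) (blockPerm ρ ρs)) =
      toCollection.arrow (comp (act α ρ) fun j => act (β (ρ j)) (ρs j))

/-! ### Lax, pseudo and strict morphisms from an operad into the `Cat`-operad of categories -/

section LaxMorphism

variable {I : Type u}

/-- A sequence of sequences of objects (or of morphisms) as a sequence indexed by the
concatenation: the canonical identification of iterated products with products. -/
@[simps]
def flat (H : I → Type u) [∀ i, Category.{u} (H i)] {n : ℕ} {m : Fin n → ℕ}
    (d : ∀ j, Fin (m j) → I) : (∀ j k, H (d j k)) ⥤ ∀ t, H (concat d t) where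
  obj x := fun t => x (pos t).1 (pos t).2
  map f := fun t => f (pos t).1 (pos t).2

variable {H : I → Type u} [∀ i, Category.{u} (H i)]

theorem obj_congr {T : Collection I}
    (P : ∀ {n : ℕ} {c : Fin n → I} {i : I}, T.Op c i → ((∀ j, H (c j)) ⥤ H i))
    {n n' : ℕ} {c : Fin n → I} {c' : Fin n' → I} {i : I} {α : T.Op c i} {α' : T.Op c' i}
    (h : T.arrow α = T.arrow α') (x : ∀ j, H (c j)) (x' : ∀ j, H (c' j))
    (hx : ∀ (j : Fin n) (j' : Fin n'), (j : ℕ) = j' → HEq (x j) (x' j')) :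
    (P α).obj x = (P α').obj x' := by
  cases h
  obtain rfl : x = x' := funext fun j => eq_of_heq (hx j j rfl)
  rfl

theorem flat_unit_right {n : ℕ} {c : Fin n → I} (x : ∀ j, H (c j))
    (t : Fin (∑ _j : Fin n, 1)) (j : Fin n) (h : (t : ℕ) = j) :
    HEq ((flat H fun j (_ : Fin 1) => c j).obj (fun j _ => x j) t) (x j) := by
  obtain rfl : (pos t).1 = j := Fin.ext ((pos_unit_right t).trans h)
  rfl

theorem flat_unit_left {n : ℕ} {c : Fin n → I} (x : ∀ j, H (c j))
    (t : Fin (∑ _j : Fin 1, n)) (j : Fin n) (h : (t : ℕ) = j) :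
    HEq ((flat H fun (_ : Fin 1) => c).obj (fun _ => x) t) (x j) := by
  obtain rfl : (pos t).2 = j := Fin.ext ((pos_unit_left t).trans h)
  rfl

theorem flat_flat {n : ℕ} {m : Fin n → ℕ} {p : ∀ j, Fin (m j) → ℕ}
    {e : ∀ j k, Fin (p j k) → I} (x : ∀ j k l, H (e j k l))
    (t : Fin (∑ s, concat p s)) (t' : Fin (∑ j, ∑ k, p j k)) (h : (t : ℕ) = t') :
    HEq ((flat H fun s : Fin (∑ j, m j) => e (pos s).1 (pos s).2).obj
        (fun s => x (pos s).1 (pos s).2) t)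
      ((flat H fun j => concat (e j)).obj (fun j => (flat H (e j)).obj (x j)) t') := by
  have h' := pos_assoc t t' h
  exact congr_arg_heq (fun q : (j : Fin n) × (k : Fin (m j)) × Fin (p j k) => x q.1 q.2.1 q.2.2) h'

theorem flat_blockPerm {n n' : ℕ} {m : Fin n → ℕ} {d : ∀ j, Fin (m j) → I} {m' : Fin n' → ℕ}
    (ρ : Fin n' ≃ Fin n) (ρs : ∀ j, Fin (m' j) ≃ Fin (m (ρ j))) (x : ∀ j k, H (d j k))
    (t t' : Fin (∑ j, m' j)) (h : (t : ℕ) = t') :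
    HEq ((flat H fun j => d (ρ j) ∘ ρs j).obj (fun j k => x (ρ j) (ρs j k)) t)
      ((flat H d).obj x (blockPerm ρ ρs t')) := by
  obtain rfl := Fin.ext h
  exact congr_arg_heq (fun q : (j : Fin n) × Fin (m j) => x q.1 q.2) (pos_blockPerm ρ ρs t).symm

variable (T : Operad I)

/-- The structure of a lax morphism of operads `T ⟶ Cat` on a family of categories `H i`. The
axioms are equations between natural transformations, stated on components; `eqToHom` stands for
the identifications of products with different bracketings. -/
structure LaxMorphism (H : I → Type u) [∀ i, Category.{u} (H i)] where
  /-- The products `H_α`. -/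
  prod : ∀ {n : ℕ} {c : Fin n → I} {i : I}, T.Op c i → ((∀ j, H (c j)) ⥤ H i)
  /-- The symmetries `ξ_{α,ρ} : H_{αρ} c_ρ ⟶ H_α`. -/
  symm : ∀ {n m : ℕ} {c : Fin n → I} {i : I} (α : T.Op c i) (ρ : Fin m ≃ Fin n),
    Pi.comap (fun j => H (c j)) ρ ⋙ prod (T.act α ρ) ⟶ prod α
  /-- The units `ν_i : 1 ⟶ H_{1_i}`. -/
  unit : ∀ i : I, 𝟭 (H i) ⟶ Functor.pi' (fun _ : Fin 1 => 𝟭 (H i)) ⋙ prod (T.one i)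
  /-- The substitutions `σ_{α,β} : H_α (∏_j H_{β_j}) ⟶ H_{α(β_j)_j}`. -/
  subst : ∀ {n : ℕ} {c : Fin n → I} {i : I} (α : T.Op c i) {m : Fin n → ℕ}
    {d : ∀ j, Fin (m j) → I} (β : ∀ j, T.Op (d j) (c j)),
    Functor.pi (fun j => prod (β j)) ⋙ prod α ⟶ flat H d ⋙ prod (T.comp α β)
  symm_refl : ∀ {n : ℕ} {c : Fin n → I} {i : I} (α : T.Op c i) (x : ∀ j, H (c j)),
    (symm α (Equiv.refl _)).app x =
      eqToHom (congrArg (fun β => (prod β).obj x) (T.act_refl α))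
  symm_trans : ∀ {n m l : ℕ} {c : Fin n → I} {i : I} (α : T.Op c i) (ρ : Fin m ≃ Fin n)
    (τ : Fin l ≃ Fin m) (x : ∀ j, H (c j)),
    (symm α (τ.trans ρ)).app x =
      eqToHom (congrArg (fun β => (prod β).obj (fun j => x (ρ (τ j)))) (T.act_act α ρ τ).symm) ≫
        (symm (T.act α ρ) τ).app (fun j => x (ρ j)) ≫ (symm α ρ).app x
  unit_right : ∀ {n : ℕ} {c : Fin n → I} {i : I} (α : T.Op c i) (x : ∀ j, H (c j)),
    (prod α).map (fun j => (unit (c j)).app (x j)) ≫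
        (subst α fun j => T.one (c j)).app (fun j _ => x j) ≫
        eqToHom (obj_congr prod (T.comp_one α) _ _ (flat_unit_right x)) =
      𝟙 ((prod α).obj x)
  unit_left : ∀ {n : ℕ} {c : Fin n → I} {i : I} (α : T.Op c i) (x : ∀ j, H (c j)),
    (unit i).app ((prod α).obj x) ≫
        (subst (T.one i) fun _ => α).app (fun _ => x) ≫
        eqToHom (obj_congr prod (T.one_comp α) _ _ (flat_unit_left x)) =
      𝟙 ((prod α).obj x)
  subst_symm : ∀ {n n' : ℕ} {c : Fin n → I} {i : I} (α : T.Op c i) {m : Fin n → ℕ}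
    {d : ∀ j, Fin (m j) → I} (β : ∀ j, T.Op (d j) (c j)) (ρ : Fin n' ≃ Fin n) {m' : Fin n' → ℕ}
    (ρs : ∀ j, Fin (m' j) ≃ Fin (m (ρ j))) (x : ∀ j k, H (d j k)),
    (prod (T.act α ρ)).map (fun j => (symm (β (ρ j)) (ρs j)).app (x (ρ j))) ≫
        (symm α ρ).app (fun j => (prod (β j)).obj (x j)) ≫ (subst α β).app x =
      (subst (T.act α ρ) fun j => T.act (β (ρ j)) (ρs j)).app (fun j k => x (ρ j) (ρs j k)) ≫
        eqToHom (obj_congr prod (T.equivariance α β ρ ρs).symm _ _ (flat_blockPerm ρ ρs x)) ≫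
        (symm (T.comp α β) (blockPerm ρ ρs)).app ((flat H d).obj x)
  subst_assoc : ∀ {n : ℕ} {c : Fin n → I} {i : I} (α : T.Op c i) {m : Fin n → ℕ}
    {d : ∀ j, Fin (m j) → I} (β : ∀ j, T.Op (d j) (c j)) {p : ∀ j, Fin (m j) → ℕ}
    {e : ∀ j k, Fin (p j k) → I} (γ : ∀ j k, T.Op (e j k) (d j k)) (x : ∀ j k l, H (e j k l)),
    (subst α β).app (fun j k => (prod (γ j k)).obj (x j k)) ≫
        (subst (T.comp α β) fun t => γ (pos t).1 (pos t).2).app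
          (fun t => x (pos t).1 (pos t).2) ≫
        eqToHom (obj_congr prod (T.assoc α β γ) _ _ (flat_flat x)) =
      (prod α).map (fun j => (subst (β j) (γ j)).app (x j)) ≫
        (subst α fun j => T.comp (β j) (γ j)).app (fun j => (flat H (e j)).obj (x j))

namespace LaxMorphism

variable {T}

/-- A lax morphism is a pseudo morphism if its units and substitutions are invertible. -/
def IsPseudo (M : LaxMorphism T H) : Prop :=
  (∀ i, IsIso (M.unit i)) ∧
    ∀ {n : ℕ} {c : Fin n → I} {i : I} (α : T.Op c i) {m : Fin n → ℕ}
      {d : ∀ j, Fin (m j) → I} (β : ∀ j, T.Op (d j) (c j)), IsIso (M.subst α β)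

/-- A lax morphism is a strict morphism if its units and substitutions are identities. -/
def IsStrict (M : LaxMorphism T H) : Prop :=
  (∀ i, ∃ h, M.unit i = eqToHom h) ∧
    ∀ {n : ℕ} {c : Fin n → I} {i : I} (α : T.Op c i) {m : Fin n → ℕ}
      {d : ∀ j, Fin (m j) → I} (β : ∀ j, T.Op (d j) (c j)), ∃ h, M.subst α β = eqToHom h

end LaxMorphism

end LaxMorphism

/-! ### 2-monads and their algebras -/

section TwoMonad

open Bicategory

/-- A (strict) 2-monad on a 2-category. -/
structure TwoMonad (K : Type*) [Bicategory K] [Bicategory.Strict K] where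
  /-- The underlying 2-functor. -/
  T : StrictPseudofunctor K K
  /-- The unit. -/
  η : ∀ A : K, A ⟶ T.obj A
  /-- The multiplication. -/
  μ : ∀ A : K, T.obj (T.obj A) ⟶ T.obj A
  η_naturality : ∀ {A B : K} (f : A ⟶ B), f ≫ η B = η A ≫ T.map f
  η_naturality₂ : ∀ {A B : K} {f g : A ⟶ B} (φ : f ⟶ g),
    φ ▷ η B = eqToHom (η_naturality f) ≫ η A ◁ T.map₂ φ ≫ eqToHom (η_naturality g).symm
  μ_naturality : ∀ {A B : K} (f : A ⟶ B), T.map (T.map f) ≫ μ B = μ A ≫ T.map f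
  μ_naturality₂ : ∀ {A B : K} {f g : A ⟶ B} (φ : f ⟶ g),
    T.map₂ (T.map₂ φ) ▷ μ B =
      eqToHom (μ_naturality f) ≫ μ A ◁ T.map₂ φ ≫ eqToHom (μ_naturality g).symm
  left_unit : ∀ A : K, η (T.obj A) ≫ μ A = 𝟙 _
  right_unit : ∀ A : K, T.map (η A) ≫ μ A = 𝟙 _
  assoc : ∀ A : K, T.map (μ A) ≫ μ A = μ (T.obj A) ≫ μ A

variable {K : Type*} [Bicategory K] [Bicategory.Strict K]

/-- A lax algebra structure on the object `A`. Composites are written in diagrammatic order, and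
`eqToHom` stands for the identity 2-cells between equal 1-cells. -/
structure LaxAlgebra (M : TwoMonad K) (A : K) where
  /-- The action. -/
  act : M.T.obj A ⟶ A
  /-- The unit coherence 2-cell. -/
  unit : 𝟙 A ⟶ M.η A ≫ act
  /-- The multiplication coherence 2-cell. -/
  mult : M.T.map act ≫ act ⟶ M.μ A ≫ act
  unit_left :
    act ◁ unit ≫
        eqToHom (by rw [← Bicategory.Strict.assoc, M.η_naturality, Bicategory.Strict.assoc]) ≫
        M.η (M.T.obj A) ◁ mult =
      eqToHom (by
        rw [Bicategory.Strict.comp_id, ← Bicategory.Strict.assoc, M.left_unit,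
          Bicategory.Strict.id_comp])
  unit_right :
    M.T.map₂ unit ▷ act ≫
        eqToHom (by rw [M.T.map_comp, Bicategory.Strict.assoc]) ≫
        M.T.map (M.η A) ◁ mult =
      eqToHom (by
        rw [M.T.map_id, ← Bicategory.Strict.assoc, M.right_unit])
  assoc :
    M.T.map (M.T.map act) ◁ mult ≫
        eqToHom (by
          rw [← Bicategory.Strict.assoc, M.μ_naturality, Bicategory.Strict.assoc]) ≫
        M.μ (M.T.obj A) ◁ mult =
      eqToHom (by rw [M.T.map_comp, Bicategory.Strict.assoc]) ≫
        M.T.map₂ mult ▷ act ≫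
        eqToHom (by rw [M.T.map_comp, Bicategory.Strict.assoc]) ≫
        M.T.map (M.μ A) ◁ mult ≫
        eqToHom (by
          rw [← Bicategory.Strict.assoc, M.assoc, Bicategory.Strict.assoc])

namespace LaxAlgebra

variable {M : TwoMonad K} {A : K}

/-- A lax algebra is a pseudo algebra if its coherence 2-cells are invertible. -/
def IsPseudo (a : LaxAlgebra M A) : Prop := IsIso a.unit ∧ IsIso a.mult

/-- A lax algebra is a strict algebra if its coherence 2-cells are identities. -/
def IsStrict (a : LaxAlgebra M A) : Prop :=
  (∃ h, a.unit = eqToHom h) ∧ ∃ h, a.mult = eqToHom h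

end LaxAlgebra

end TwoMonad

/-! ### The 2-category of categories over a set of colours -/

section CatOver

/-- A small category equipped with a functor to the discrete category on `I`. -/
structure CatOver (I : Type u) where
  /-- The underlying category. -/
  carrier : Type u
  [category : Category.{u} carrier]
  /-- The functor to `I`. -/
  proj : carrier ⥤ Discrete I

attribute [instance] CatOver.category

namespace CatOver

variable {I : Type u}

/-- A functor over `I`. -/
@[ext]
structure Hom (X Y : CatOver I) where
  /-- The underlying functor. -/
  functor : X.carrier ⥤ Y.carrier
  comm : functor ⋙ Y.proj = X.proj

/-- A natural transformation over `I`, that is, with components in the fibres (which, `I` being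
discrete, holds for every natural transformation). -/
@[ext]
structure Hom₂ {X Y : CatOver I} (F G : Hom X Y) where
  /-- The underlying natural transformation. -/
  nat : F.functor ⟶ G.functor
  comm : Functor.whiskerRight nat Y.proj = eqToHom (F.comm.trans G.comm.symm) := by
    ext; apply Subsingleton.elim

instance : CategoryStruct (CatOver I) where
  Hom := Hom
  id X := ⟨𝟭 _, rfl⟩
  comp F G := ⟨F.functor ⋙ G.functor, by rw [Functor.assoc, G.comm, F.comm]⟩

instance (X Y : CatOver I) : Category (X ⟶ Y) where
  Hom F G := Hom₂ F G
  id F := { nat := 𝟙 _ }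
  comp φ ψ := { nat := φ.nat ≫ ψ.nat }

@[ext]
theorem hom₂_ext {X Y : CatOver I} {F G : X ⟶ Y} {φ ψ : F ⟶ G} (h : φ.nat = ψ.nat) : φ = ψ :=
  Hom₂.ext h

@[simp]
theorem id_nat {X Y : CatOver I} (F : X ⟶ Y) : (𝟙 F : F ⟶ F).nat = 𝟙 _ := rfl

@[simp]
theorem comp_nat {X Y : CatOver I} {F G H : X ⟶ Y} (φ : F ⟶ G) (ψ : G ⟶ H) :
    (φ ≫ ψ).nat = φ.nat ≫ ψ.nat := rfl

@[simp]
theorem id_functor (X : CatOver I) : (𝟙 X : X ⟶ X).functor = 𝟭 _ := rfl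

@[simp]
theorem comp_functor {X Y Z : CatOver I} (F : X ⟶ Y) (G : Y ⟶ Z) :
    (F ≫ G).functor = F.functor ⋙ G.functor := rfl

/-- The 2-cell given by a natural transformation. -/
def mk₂ {X Y : CatOver I} {F G : X ⟶ Y} (φ : F.functor ⟶ G.functor) : F ⟶ G :=
  { nat := φ : Hom₂ F G }

@[simp]
theorem mk₂_nat {X Y : CatOver I} {F G : X ⟶ Y} (φ : F.functor ⟶ G.functor) :
    (mk₂ φ).nat = φ := rfl

theorem hom_ext {X Y : CatOver I} {F G : X ⟶ Y} (h : F.functor = G.functor) : F = G :=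
  Hom.ext h

@[simp]
theorem eqToHom_nat {X Y : CatOver I} {F G : X ⟶ Y} (h : F = G) :
    (eqToHom h : F ⟶ G).nat = eqToHom (congrArg Hom.functor h) := by
  subst h; rfl

theorem eq_eqToHom_comp {X Y : CatOver I} {F F' G G' : X ⟶ Y} (φ : F ⟶ G) (ψ : F' ⟶ G')
    (hF : F = F') (hG : G' = G) (h : ∀ x, HEq (φ.nat.app x) (ψ.nat.app x)) :
    φ = eqToHom hF ≫ ψ ≫ eqToHom hG := by
  subst hF hG
  simp only [eqToHom_refl, Category.id_comp, Category.comp_id]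
  exact hom₂_ext (NatTrans.ext (funext fun x => eq_of_heq (h x)))

/-- Equal functors over `I` are isomorphic through the identity. -/
@[simps]
def isoOfEq {X Y : CatOver I} {F G : X ⟶ Y} (h : F = G) : F ≅ G where
  hom := mk₂ (eqToHom (congrArg Hom.functor h))
  inv := mk₂ (eqToHom (congrArg Hom.functor h).symm)

/-- The 2-category `Cat/I`. -/
instance : Bicategory (CatOver I) where
  homCategory X Y := inferInstanceAs (Category (X ⟶ Y))
  whiskerLeft F _ _ φ := mk₂ (Functor.whiskerLeft F.functor (Hom₂.nat φ))
  whiskerRight φ G := mk₂ (Functor.whiskerRight (Hom₂.nat φ) G.functor)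
  associator F G H := isoOfEq rfl
  leftUnitor F := isoOfEq rfl
  rightUnitor F := isoOfEq rfl

open Bicategory

@[simp]
theorem whiskerLeft_nat {X Y Z : CatOver I} (F : X ⟶ Y) {G G' : Y ⟶ Z} (φ : G ⟶ G') :
    (F ◁ φ).nat = Functor.whiskerLeft F.functor φ.nat := rfl

@[simp]
theorem whiskerRight_nat {X Y Z : CatOver I} {F F' : X ⟶ Y} (φ : F ⟶ F') (G : Y ⟶ Z) :
    (φ ▷ G).nat = Functor.whiskerRight φ.nat G.functor := rfl

instance : Bicategory.Strict (CatOver I) where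
  id_comp _ := rfl
  comp_id _ := rfl
  assoc _ _ _ := rfl

/-- The colour of an object. -/
abbrev colour (X : CatOver I) (x : X.carrier) : I := (X.proj.obj x).as

/-- The fibre over a colour. -/
abbrev Fib (X : CatOver I) (i : I) : Type u := X.proj.Fiber (Discrete.mk i)

/-- An object in the fibre over its colour. -/
abbrev inFib (X : CatOver I) (x : X.carrier) : X.Fib (X.colour x) := ⟨x, rfl⟩

/-- A functor over `I` acts on fibres. -/
def Hom.onFib {X Y : CatOver I} (F : X ⟶ Y) {i : I} (x : X.Fib i) : Y.Fib i :=
  ⟨F.functor.obj x.1, (Functor.congr_obj F.comm x.1).trans x.2⟩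

/-- As `I` is discrete, the fibres are full subcategories. -/
theorem isHomLift (X : CatOver I) {i : I} (x y : X.Fib i) (f : x.1 ⟶ y.1) :
    X.proj.IsHomLift (𝟙 (Discrete.mk i)) f :=
  IsHomLift.of_commsq _ _ _ x.2 y.2 (Subsingleton.elim _ _)

end CatOver

end CatOver

/-! ### The polynomial 2-monad of an operad -/

section Polynomial

variable {I : Type u}

namespace Collection

variable {T : Collection I}

namespace Arrow

/-- The arrow `αρ`. -/
def act (b : T.Arrow) {n : ℕ} (ρ : Fin n ≃ Fin b.arity) : T.Arrow :=
  ⟨n, b.src ∘ ρ, b.tgt, T.act b.op ρ⟩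

theorem act_refl (b : T.Arrow) : b.act (Equiv.refl _) = b := by
  obtain ⟨n, c, i, α⟩ := b
  simp only [act]
  congr 1
  exact T.act_refl α

theorem act_act (b : T.Arrow) {n m : ℕ} (ρ : Fin n ≃ Fin b.arity) (τ : Fin m ≃ Fin n) :
    (b.act ρ).act τ = b.act (τ.trans ρ) := by
  simp only [act]
  congr 1
  exact T.act_act b.op ρ τ

theorem act_trans {b c : T.Arrow} (τ : Fin b.arity ≃ Fin c.arity) (h : b = c.act τ) {n : ℕ}
    (ρ : Fin n ≃ Fin b.arity) : b.act ρ = c.act (ρ.trans τ) := by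
  have aux : ∀ {m : ℕ} {d : Fin m → I} {i : I} (β : T.Op d i) (τ : Fin m ≃ Fin c.arity)
      (ρ : Fin n ≃ Fin m), T.arrow β = c.act τ → (T.arrow β).act ρ = c.act (ρ.trans τ) := by
    intro m d i β τ ρ h
    simp only [act, mk.injEq, true_and] at h
    obtain ⟨h1, h2, h3⟩ := h
    subst h1 h2
    obtain rfl := eq_of_heq h3
    exact act_act c τ ρ
  exact aux b.op τ ρ h

/-- A morphism `a ⟶ b` between arrows of a collection is a permutation `ρ` with `a = bρ`. -/
@[ext]
structure Hom (a b : T.Arrow) where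
  /-- The permutation. -/
  perm : Fin a.arity ≃ Fin b.arity
  eq_act : a = b.act perm

/-- The category `B_T` of arrows of `T`. -/
instance : Category T.Arrow where
  Hom := Hom
  id a := ⟨Equiv.refl _, a.act_refl.symm⟩
  comp {a b c} f g := ⟨f.perm.trans g.perm, by
    exact f.eq_act.trans (act_trans g.perm g.eq_act f.perm)⟩

@[simp]
theorem id_perm (a : T.Arrow) : Hom.perm (𝟙 a) = Equiv.refl _ := rfl

@[simp]
theorem comp_perm {a b c : T.Arrow} (f : a ⟶ b) (g : b ⟶ c) :
    Hom.perm (f ≫ g) = (Hom.perm f).trans (Hom.perm g) := rfl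

theorem Hom.tgt_eq {a b : T.Arrow} (f : a ⟶ b) : a.tgt = b.tgt :=
  (congrArg Arrow.tgt (Hom.eq_act f) :)

theorem src_heq {a b : T.Arrow} (h : a = b) (j : Fin a.arity) (j' : Fin b.arity)
    (hj : (j : ℕ) = j') : a.src j = b.src j' := by
  subst h
  rw [Fin.ext hj]

theorem Hom.src_eq {a b : T.Arrow} (f : a ⟶ b) (j : Fin a.arity) :
    a.src j = b.src (Hom.perm f j) :=
  src_heq (Hom.eq_act f) j j rfl

end Arrow

/-- An object `(α, j)` of `E_T`: an arrow together with one of its inputs. -/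
structure Input (T : Collection I) where
  /-- The arrow. -/
  arrow : T.Arrow
  /-- The input. -/
  idx : Fin arrow.arity

/-- The category `E_T`: a morphism `(α, j) ⟶ (β, k)` is a morphism `ρ : α ⟶ β` of `B_T` with
`ρ j = k`. -/
instance : Category T.Input where
  Hom a b := { f : a.arrow ⟶ b.arrow // Arrow.Hom.perm f a.idx = b.idx }
  id a := ⟨𝟙 _, rfl⟩
  comp f g := ⟨f.1 ≫ g.1, by simp [f.2, g.2]⟩

/-- The functor `s_T : E_T ⟶ I`. -/
def polyS (T : Collection I) : T.Input ⥤ Discrete I where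
  obj a := ⟨a.arrow.src a.idx⟩
  map {a b} f := eqToHom (by rw [Arrow.Hom.src_eq f.1 a.idx, f.2])

/-- The functor `p_T : E_T ⟶ B_T`. -/
def polyP (T : Collection I) : T.Input ⥤ T.Arrow where
  obj a := a.arrow
  map f := f.1

/-- The functor `t_T : B_T ⟶ I`. -/
def polyT (T : Collection I) : T.Arrow ⥤ Discrete I where
  obj a := ⟨a.tgt⟩
  map f := eqToHom (by rw [Arrow.Hom.tgt_eq f])

/-- An operation of `T` labelled in `X`: an arrow `α` together with an object of `X` of the right
colour for each input, in other words a functor over `I` to `X` from the fibre of `p_T` at `α`. -/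
structure Labelled (T : Collection I) (X : CatOver I) where
  /-- The operation. -/
  arrow : T.Arrow
  /-- The labels. -/
  label : ∀ j, X.Fib (arrow.src j)

namespace Labelled

variable {X Y Z : CatOver I}

/-- A morphism of labelled operations: a morphism `ρ` of `B_T` and morphisms `x_j ⟶ y_{ρj}`. -/
structure Hom (a b : T.Labelled X) where
  /-- The permutation. -/
  base : a.arrow ⟶ b.arrow
  /-- The morphisms between the labels. -/
  map : ∀ j, (a.label j).1 ⟶ (b.label (Arrow.Hom.perm base j)).1

/-- The permutation underlying a morphism of labelled operations. -/
abbrev Hom.perm {a b : T.Labelled X} (f : Hom a b) : Fin a.arrow.arity ≃ Fin b.arrow.arity :=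
  Arrow.Hom.perm f.base

theorem Hom.ext' {a b : T.Labelled X} {f g : Hom a b} (h : ∀ j, f.perm j = g.perm j)
    (h' : ∀ j, HEq (f.map j) (g.map j)) : f = g := by
  obtain ⟨⟨ρ, hρ⟩, γ⟩ := f
  obtain ⟨⟨τ, hτ⟩, δ⟩ := g
  obtain rfl : ρ = τ := Equiv.ext h
  obtain rfl : γ = δ := funext fun j => eq_of_heq (h' j)
  rfl

instance : Category (T.Labelled X) where
  Hom := Hom
  id a := ⟨𝟙 _, fun _ => 𝟙 _⟩
  comp f g := ⟨f.base ≫ g.base, fun j => f.map j ≫ g.map (f.perm j)⟩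
  id_comp f := Hom.ext' (fun _ => rfl) fun _ => heq_of_eq (Category.id_comp _)
  comp_id f := Hom.ext' (fun _ => rfl) fun _ => heq_of_eq (Category.comp_id _)
  assoc f g h := Hom.ext' (fun _ => rfl) fun _ => heq_of_eq (Category.assoc _ _ _)

theorem obj_ext {a b : T.Labelled X} (h : a.arrow = b.arrow)
    (h' : ∀ (j : Fin a.arrow.arity) (j' : Fin b.arrow.arity), (j : ℕ) = j' →
      (a.label j).1 = (b.label j').1) : a = b := by
  obtain ⟨a, x⟩ := a
  obtain ⟨b, y⟩ := b
  obtain rfl : a = b := h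
  obtain rfl : x = y := funext fun j => Subtype.ext (h' j j rfl)
  rfl

theorem hom_heq {a a' b b' : T.Labelled X} (ha : a = a') (hb : b = b') (f : a ⟶ b) (g : a' ⟶ b')
    (h : ∀ (j : Fin a.arrow.arity) (j' : Fin a'.arrow.arity), (j : ℕ) = j' →
      (Hom.perm f j : ℕ) = Hom.perm g j')
    (h' : ∀ (j : Fin a.arrow.arity) (j' : Fin a'.arrow.arity), (j : ℕ) = j' →
      HEq (Hom.map f j) (Hom.map g j')) : HEq f g := by
  subst ha hb
  exact heq_of_eq (Hom.ext' (fun j => Fin.ext (h j j rfl)) fun j => h' j j rfl)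

end Labelled

theorem Labelled.perm_comp_eqToHom {X : CatOver I} {a b c : T.Labelled X} (f : a ⟶ b) (h : b = c)
    (j : Fin a.arrow.arity) : (Hom.perm (f ≫ eqToHom h) j : ℕ) = Hom.perm f j := by
  subst h
  rfl

theorem Labelled.map_comp_eqToHom {X : CatOver I} {a b c : T.Labelled X} (f : a ⟶ b) (h : b = c)
    (j : Fin a.arrow.arity) : HEq (Hom.map (f ≫ eqToHom h) j) (Hom.map f j) := by
  subst h
  rw [eqToHom_refl, Category.comp_id]

/-- The category `TX` of operations of `T` labelled in `X`, over `I` by the target. -/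
abbrev label (T : Collection I) (X : CatOver I) : CatOver I where
  carrier := T.Labelled X
  proj :=
    { obj := fun a => ⟨a.arrow.tgt⟩
      map := fun f => eqToHom (by rw [Arrow.Hom.tgt_eq (Labelled.Hom.base f)]) }

/-- The pullback of `p_T : E_T ⟶ B_T` along a functor `q`; as `p_T` is a discrete fibration and
opfibration, its objects over `y` are the inputs of the arrow `q y`. -/
structure PullbackInput {T : Collection I} {Y : Type u} [Category.{u} Y] (q : Y ⥤ T.Arrow) where
  /-- The object of `Y`. -/
  pt : Y
  /-- The input. -/
  idx : Fin (q.obj pt).arity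

namespace PullbackInput

variable {Y : Type u} [Category.{u} Y]

instance (q : Y ⥤ T.Arrow) : Category (PullbackInput q) where
  Hom a b := { f : a.pt ⟶ b.pt // Arrow.Hom.perm (q.map f) a.idx = b.idx }
  id a := ⟨𝟙 _, by simp⟩
  comp f g := ⟨f.1 ≫ g.1, by simp [f.2, g.2]⟩

/-- The projection of the pullback to `E_T`. -/
def toInput (q : Y ⥤ T.Arrow) : PullbackInput q ⥤ T.Input where
  obj a := ⟨q.obj a.pt, a.idx⟩
  map f := ⟨q.map f.1, f.2⟩
  map_id _ := Subtype.ext (q.map_id _)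
  map_comp _ _ := Subtype.ext (q.map_comp _ _)

end PullbackInput

/-- The functor `TX ⟶ B_T`. -/
def Labelled.toArrow (T : Collection I) (X : CatOver I) : T.Labelled X ⥤ T.Arrow where
  obj a := a.arrow
  map f := f.base

/-- The morphism between the labels of the inputs `j` and `k = ρ j`. -/
def Labelled.Hom.mapTo {X : CatOver I} {a b : T.Labelled X} (f : a ⟶ b) (j : Fin a.arrow.arity)
    (k : Fin b.arrow.arity) (h : Hom.perm f j = k) : (a.label j).1 ⟶ (b.label k).1 :=
  Hom.map f j ≫ eqToHom (congrArg (fun k => (b.label k).1) h)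

theorem Labelled.Hom.mapTo_self {X : CatOver I} {a b : T.Labelled X} (f : a ⟶ b)
    (j : Fin a.arrow.arity) : mapTo f j _ rfl = Hom.map f j :=
  Category.comp_id _

theorem Labelled.Hom.mapTo_id {X : CatOver I} {a : T.Labelled X} (f : a ⟶ a) (hf : f = 𝟙 a)
    (j : Fin a.arrow.arity) (h : Hom.perm f j = j) : mapTo f j j h = 𝟙 _ := by
  subst hf
  exact Category.comp_id _

theorem Labelled.Hom.mapTo_comp {X : CatOver I} {a b c : T.Labelled X} (f : a ⟶ b) (g : b ⟶ c)
    (e : a ⟶ c) (he : e = f ≫ g) (j : Fin a.arrow.arity) (k : Fin b.arrow.arity)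
    (l : Fin c.arrow.arity) (h : Hom.perm f j = k) (h' : Hom.perm g k = l)
    (h'' : Hom.perm e j = l) : mapTo e j l h'' = mapTo f j k h ≫ mapTo g k l h' := by
  subst he h h'
  rw [mapTo_self, mapTo_self]
  exact mapTo_self _ _

/-- The evaluation `Y ×_{B_T} E_T ⟶ X` at the inputs, for a functor `Y ⟶ TX`. -/
def Labelled.eval {X : CatOver I} {Y : Type u} [Category.{u} Y] (K : Y ⥤ T.Labelled X) :
    PullbackInput (K ⋙ Labelled.toArrow T X) ⥤ X.carrier where
  obj a := ((K.obj a.pt).label a.idx).1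
  map {a b} f := Labelled.Hom.mapTo (K.map f.1) a.idx b.idx f.2
  map_id a := Labelled.Hom.mapTo_id _ (K.map_id a.pt) _ _
  map_comp f g := Labelled.Hom.mapTo_comp _ _ _ (K.map_comp f.1 g.1) _ _ _ _ _ _

theorem PullbackInput.map_heq {X : CatOver I} {Y : Type u} [Category.{u} Y] {q : Y ⥤ T.Arrow}
    (L : PullbackInput q ⥤ X.carrier) {a b b' : PullbackInput q} (h : b = b') (f : a ⟶ b)
    (g : a ⟶ b') (hfg : HEq f.1 g.1) : HEq (L.map f) (L.map g) := by
  subst h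
  rw [Subtype.ext (eq_of_heq hfg)]

/-- The functor `Y ⟶ TX` given by a functor `q : Y ⟶ B_T` and labels of the inputs. -/
def Labelled.ofEval {X : CatOver I} {Y : Type u} [Category.{u} Y] (q : Y ⥤ T.Arrow)
    (L : PullbackInput q ⥤ X.carrier) (h : L ⋙ X.proj = PullbackInput.toInput q ⋙ T.polyS) :
    Y ⥤ T.Labelled X where
  obj y := ⟨q.obj y, fun j => ⟨L.obj ⟨y, j⟩, Functor.congr_obj h ⟨y, j⟩⟩⟩
  map {y z} f := ⟨q.map f, fun j =>
    L.map (X := ⟨y, j⟩) (Y := ⟨z, Arrow.Hom.perm (q.map f) j⟩) ⟨f, rfl⟩⟩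
  map_id y := Labelled.Hom.ext' (fun j => congrArg (fun e => Arrow.Hom.perm e j) (q.map_id y)) fun j => by
    refine HEq.trans ?_ (heq_of_eq (L.map_id ⟨y, j⟩))
    exact PullbackInput.map_heq L (congrArg (fun e => PullbackInput.mk y (Arrow.Hom.perm e j)) (q.map_id y)) _ _ HEq.rfl
  map_comp {x y z} f g := Labelled.Hom.ext' (fun j => congrArg (fun e => Arrow.Hom.perm e j) (q.map_comp f g)) fun j => by
    refine HEq.trans ?_ (heq_of_eq (L.map_comp (X := ⟨x, j⟩)
      (Y := ⟨y, Arrow.Hom.perm (q.map f) j⟩)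
      (Z := ⟨z, Arrow.Hom.perm (q.map g) (Arrow.Hom.perm (q.map f) j)⟩) ⟨f, rfl⟩ ⟨g, rfl⟩))
    exact PullbackInput.map_heq L (congrArg (fun e => PullbackInput.mk z (Arrow.Hom.perm e j)) (q.map_comp f g)) _ _ HEq.rfl

theorem Labelled.mapTo_ofEval {X : CatOver I} {Y : Type u} [Category.{u} Y] (q : Y ⥤ T.Arrow)
    (L : PullbackInput q ⥤ X.carrier) (h : L ⋙ X.proj = PullbackInput.toInput q ⋙ T.polyS)
    {y z : Y} (f : y ⟶ z) (j : Fin (q.obj y).arity) (k : Fin (q.obj z).arity)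
    (hf : Arrow.Hom.perm (q.map f) j = k) :
    Labelled.Hom.mapTo ((Labelled.ofEval q L h).map f) j k hf =
      L.map (X := ⟨y, j⟩) (Y := ⟨z, k⟩) ⟨f, hf⟩ := by
  subst hf
  exact Labelled.Hom.mapTo_self ((Labelled.ofEval q L h).map f) j

/-- The universal property of `TX` as the value `Σ_t Π_p Δ_s X` of the polynomial functor of
`(s_T, p_T, t_T)`: functors `Y ⟶ TX` correspond to functors `q : Y ⟶ B_T` together with functors
over `I` from the pullback of `p_T` along `q` to `X`. -/
def labelledEquiv (T : Collection I) (X : CatOver I) (Y : Type u) [Category.{u} Y] :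
    (Y ⥤ T.Labelled X) ≃ (q : Y ⥤ T.Arrow) × { L : PullbackInput q ⥤ X.carrier //
      L ⋙ X.proj = PullbackInput.toInput q ⋙ T.polyS } where
  toFun K := ⟨K ⋙ Labelled.toArrow T X, Labelled.eval K, CategoryTheory.Functor.ext
    (fun a => ((K.obj a.pt).label a.idx).2) fun _ _ _ => Subsingleton.elim _ _⟩
  invFun L := Labelled.ofEval L.1 L.2.1 L.2.2
  left_inv K := by
    refine CategoryTheory.Functor.hext (fun _ => rfl) fun y z f => heq_of_eq ?_
    exact Labelled.Hom.ext' (fun _ => rfl) fun j => heq_of_eq (Labelled.Hom.mapTo_self _ _)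
  right_inv := by
    rintro ⟨q, L, h⟩
    refine Sigma.ext rfl (heq_of_eq (Subtype.ext ?_))
    refine CategoryTheory.Functor.hext (fun _ => rfl) fun a b f => heq_of_eq ?_
    exact Labelled.mapTo_ofEval q L h f.1 a.idx b.idx f.2

/-- The functor `TF : TX ⟶ TY`. -/
def labelMap (T : Collection I) {X Y : CatOver I} (F : X ⟶ Y) : T.label X ⟶ T.label Y where
  functor :=
    { obj := fun a => ⟨a.arrow, fun j => CatOver.Hom.onFib F (a.label j)⟩
      map := fun f => ⟨f.base, fun j => F.functor.map (f.map j)⟩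
      map_id := fun _ => Labelled.Hom.ext' (fun _ => rfl) fun _ => heq_of_eq (F.functor.map_id _)
      map_comp := fun _ _ =>
        Labelled.Hom.ext' (fun _ => rfl) fun _ => heq_of_eq (F.functor.map_comp _ _) }
  comm := rfl

/-- The natural transformation `Tφ : TF ⟶ TG`. -/
def labelMap₂ (T : Collection I) {X Y : CatOver I} {F G : X ⟶ Y} (φ : F ⟶ G) :
    T.labelMap F ⟶ T.labelMap G :=
  CatOver.mk₂
    { app := fun a => ⟨𝟙 a.arrow, fun j => (CatOver.Hom₂.nat φ).app (a.label j).1⟩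
      naturality := fun _ _ f =>
        Labelled.Hom.ext' (fun _ => rfl) fun j =>
          heq_of_eq ((CatOver.Hom₂.nat φ).naturality (f.map j)) }

end Collection

namespace Collection

/-- The underlying 2-functor of the 2-monad: the polynomial 2-functor `X ↦ TX`. -/
def labelFunctor (T : Collection I) : StrictPseudofunctor (CatOver I) (CatOver I) :=
  StrictPseudofunctor.mk''
    { obj := T.label
      map := T.labelMap
      map₂ := T.labelMap₂
      map₂_id := fun F => CatOver.hom₂_ext <| NatTrans.ext <| funext fun a =>
        Labelled.Hom.ext' (fun _ => rfl) fun _ => HEq.rfl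
      map₂_comp := fun φ ψ => CatOver.hom₂_ext <| NatTrans.ext <| funext fun a =>
        Labelled.Hom.ext' (fun _ => rfl) fun _ => HEq.rfl
      map_id := fun _ => rfl
      map_comp := fun _ _ => rfl
      map₂_whisker_left := fun _ _ _ _ => ((Category.id_comp _).trans (Category.comp_id _)).symm
      map₂_whisker_right := fun _ _ => ((Category.id_comp _).trans (Category.comp_id _)).symm }

end Collection

namespace Operad

open Collection

variable {T : Operad I}

/-- The composite of arrows, with the condition on sources and targets as a hypothesis. -/
def compArrow (b : T.Arrow) (β : Fin b.arity → T.Arrow) (h : ∀ j, (β j).tgt = b.src j) : T.Arrow :=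
  ⟨∑ j, (β j).arity, concat fun j => (β j).src, b.tgt,
    T.comp b.op fun j => cast (congrArg (T.Op (β j).src) (h j)) (β j).op⟩

theorem compArrow_congr {b b' : T.Arrow} {β : Fin b.arity → T.Arrow}
    {β' : Fin b'.arity → T.Arrow} {h : ∀ j, (β j).tgt = b.src j} {h' : ∀ j, (β' j).tgt = b'.src j}
    (hb : b = b') (hβ : ∀ (j : Fin b.arity) (j' : Fin b'.arity), (j : ℕ) = j' → β j = β' j') :
    compArrow b β h = compArrow b' β' h' := by
  subst hb
  obtain rfl : β = β' := funext fun j => hβ j j rfl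
  rfl

theorem one_compArrow (b : T.Arrow) {i : I} (h : ∀ _ : Fin 1, b.tgt = i) :
    compArrow (T.arrow (T.one i)) (fun _ => b) h = b := by
  obtain rfl := h 0
  exact T.one_comp b.op

theorem compArrow_one (b : T.Arrow) (e : Fin b.arity → I) (h : ∀ j, e j = b.src j) :
    compArrow b (fun j => T.arrow (T.one (e j))) h = b := by
  obtain rfl : e = b.src := funext h
  exact T.comp_one b.op

theorem compArrow_assoc (b : T.Arrow) (β : Fin b.arity → T.Arrow) (h : ∀ j, (β j).tgt = b.src j)
    (γ : ∀ j, Fin (β j).arity → T.Arrow) (h' : ∀ j k, (γ j k).tgt = (β j).src k) :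
    compArrow (compArrow b β h) (fun t => γ (pos t).1 (pos t).2) (fun _ => h' _ _) =
      compArrow b (fun j => compArrow (β j) (γ j) (h' j)) h := by
  have aux : ∀ {n : ℕ} {c : Fin n → I} {i : I} (α : T.Op c i) {m : Fin n → ℕ}
      {d : ∀ j, Fin (m j) → I} {c' : Fin n → I} (β : ∀ j, T.Op (d j) (c' j))
      {p : ∀ j, Fin (m j) → ℕ} {e : ∀ j k, Fin (p j k) → I} {d' : ∀ j, Fin (m j) → I}
      (γ : ∀ j k, T.Op (e j k) (d' j k)) (h : ∀ j, c' j = c j) (h' : ∀ j k, d' j k = d j k),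
      compArrow (compArrow (T.arrow α) (fun j => T.arrow (β j)) h)
          (fun t => T.arrow (γ (pos t).1 (pos t).2)) (fun _ => h' _ _) =
        compArrow (T.arrow α)
          (fun j => compArrow (T.arrow (β j)) (fun k => T.arrow (γ j k)) (h' j)) h := by
    intro n c i α m d c' β p e d' γ h h'
    obtain rfl : c' = c := funext h
    obtain rfl : d' = d := funext fun j => funext (h' j)
    exact T.assoc α β γ
  exact aux b.op (fun j => (β j).op) (fun j k => (γ j k).op) h h'

theorem compArrow_act (b : T.Arrow) (β : Fin b.arity → T.Arrow) (h : ∀ j, (β j).tgt = b.src j)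
    {n' : ℕ} (ρ : Fin n' ≃ Fin b.arity) {m' : Fin n' → ℕ}
    (ρs : ∀ j, Fin (m' j) ≃ Fin (β (ρ j)).arity) :
    (compArrow b β h).act (blockPerm ρ ρs) =
      compArrow (b.act ρ) (fun j => (β (ρ j)).act (ρs j)) fun j => h (ρ j) := by
  have aux : ∀ {n : ℕ} {c : Fin n → I} {i : I} (α : T.Op c i) {m : Fin n → ℕ}
      {d : ∀ j, Fin (m j) → I} {c' : Fin n → I} (β : ∀ j, T.Op (d j) (c' j))
      (h : ∀ j, c' j = c j) {n' : ℕ} (ρ : Fin n' ≃ Fin n) {m' : Fin n' → ℕ}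
      (ρs : ∀ j, Fin (m' j) ≃ Fin (m (ρ j))),
      (compArrow (T.arrow α) (fun j => T.arrow (β j)) h).act (blockPerm ρ ρs) =
        compArrow ((T.arrow α).act ρ) (fun j => (T.arrow (β (ρ j))).act (ρs j))
          fun j => h (ρ j) := by
    intro n c i α m d c' β h n' ρ m' ρs
    obtain rfl : c' = c := funext h
    exact T.equivariance α β ρ ρs
  exact aux b.op (fun j => (β j).op) h ρ ρs

/-- The composite of morphisms of arrows. -/
def compHom {b b' : T.Arrow} (f : b ⟶ b') {β : Fin b.arity → T.Arrow}
    {β' : Fin b'.arity → T.Arrow} (h : ∀ j, (β j).tgt = b.src j) (h' : ∀ j, (β' j).tgt = b'.src j)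
    (g : ∀ j, β j ⟶ β' (Arrow.Hom.perm f j)) : compArrow b β h ⟶ compArrow b' β' h' :=
  ⟨blockPerm (Arrow.Hom.perm f) fun j => Arrow.Hom.perm (g j), by
    refine (compArrow_congr (Arrow.Hom.eq_act f) fun j j' hj => ?_).trans
      (compArrow_act b' β' h' (Arrow.Hom.perm f) fun j => Arrow.Hom.perm (g j)).symm
    obtain rfl := Fin.ext hj
    exact Arrow.Hom.eq_act (g j)⟩

/-- The unit `η_X(x) = (1_i, (x))`. -/
def unitHom (T : Operad I) (X : CatOver I) : X ⟶ T.label X where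
  functor :=
    { obj := fun x => ⟨T.arrow (T.one (X.colour x)), fun _ => X.inFib x⟩
      map := fun {x y} f => ⟨⟨Equiv.refl _,
        (congrArg (fun i => T.arrow (T.one i)) (Discrete.eq_of_hom (X.proj.map f))).trans
          (Arrow.act_refl _).symm⟩,
        fun _ => f⟩
      map_id := fun _ => Labelled.Hom.ext' (fun _ => rfl) fun _ => HEq.rfl
      map_comp := fun _ _ => Labelled.Hom.ext' (fun _ => rfl) fun _ => HEq.rfl }
  comm := by
    refine CategoryTheory.Functor.ext (fun _ => rfl) fun _ _ _ => Subsingleton.elim _ _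

/-- The object map of the multiplication. -/
def multObj {X : CatOver I} (a : T.Labelled (T.label X)) : T.Labelled X :=
  ⟨compArrow a.arrow (fun j => (a.label j).1.arrow) fun j => congrArg Discrete.as (a.label j).2,
    fun t => (a.label (pos t).1).1.label (pos t).2⟩

/-- The label of the composite labelled operation at the position `(j, k)`. -/
abbrev innerLabel {X : CatOver I} (a : T.Labelled (T.label X))
    (q : (j : Fin a.arrow.arity) × Fin (a.label j).1.arrow.arity) : X.carrier :=
  ((a.label q.1).1.label q.2).1

/-- The morphism map of the multiplication. -/
def multMap {X : CatOver I} {a b : T.Labelled (T.label X)} (f : a ⟶ b) : multObj a ⟶ multObj b :=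
  ⟨compHom (Labelled.Hom.base f) (fun j => congrArg Discrete.as (a.label j).2)
      (fun j => congrArg Discrete.as (b.label j).2) fun j => (f.map j).base,
    fun t => (f.map (pos t).1).map (pos t).2 ≫
      eqToHom (congrArg (innerLabel b) (pos_blockPerm (Labelled.Hom.perm f)
        (fun j => Labelled.Hom.perm (f.map j)) t).symm)⟩

theorem comp_heq_comp {ι C : Type*} [Category C] (L R : ι → C) (G : ∀ q, L q ⟶ R q) {q q' : ι}
    (h : q = q') {x y z : C} (f : x ⟶ L q) (hy : R q = y) (hz : R q' = z) (hl : L q = L q') :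
    HEq ((f ≫ G q) ≫ eqToHom hy) ((f ≫ eqToHom hl) ≫ G q' ≫ eqToHom hz) := by
  subst h hy hz
  simp

theorem multMap_id {X : CatOver I} (a : T.Labelled (T.label X)) :
    multMap (𝟙 a) = 𝟙 (multObj a) :=
  Labelled.Hom.ext' blockPerm_refl fun _ => comp_eqToHom_heq _ _

theorem multMap_comp {X : CatOver I} {a b c : T.Labelled (T.label X)} (f : a ⟶ b) (g : b ⟶ c) :
    multMap (f ≫ g) = multMap f ≫ multMap g := by
  refine Labelled.Hom.ext' (fun t => ?_) fun t => ?_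
  · exact blockPerm_trans (m'' := fun j => (a.label j).1.arrow.arity)
      (m' := fun j => (b.label j).1.arrow.arity) (m := fun j => (c.label j).1.arrow.arity)
      (Labelled.Hom.perm f) (fun j => Labelled.Hom.perm (f.map j))
      (Labelled.Hom.perm g) (fun j => Labelled.Hom.perm (g.map j)) t
  have h := (pos_blockPerm (m' := fun j => (a.label j).1.arrow.arity)
    (m := fun j => (b.label j).1.arrow.arity) (Labelled.Hom.perm f) (fun j => Labelled.Hom.perm (f.map j)) t).symm
  exact comp_heq_comp (innerLabel b)
    (fun q => innerLabel c ⟨Labelled.Hom.perm g q.1, Labelled.Hom.perm (g.map q.1) q.2⟩)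
    (fun q => (g.map q.1).map q.2) h ((f.map (pos t).1).map (pos t).2) _ _ _

/-- The multiplication `μ_X(α, (α_j, (x_{jk})_k)_j) = (α(α_j)_j, (x_{jk})_{jk})`. -/
def multHom (T : Operad I) (X : CatOver I) : T.label (T.label X) ⟶ T.label X where
  functor :=
    { obj := multObj
      map := multMap
      map_id := multMap_id
      map_comp := multMap_comp }
  comm := CategoryTheory.Functor.ext (fun _ => rfl) fun _ _ _ => Subsingleton.elim _ _

theorem functor_ext {A : Type u} [Category.{u} A] {X : CatOver I} {F G : A ⥤ T.Labelled X}
    (h₁ : ∀ a, (F.obj a).arrow = (G.obj a).arrow)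
    (h₂ : ∀ a (j : Fin (F.obj a).arrow.arity) (j' : Fin (G.obj a).arrow.arity), (j : ℕ) = j' →
      ((F.obj a).label j).1 = ((G.obj a).label j').1)
    (h₃ : ∀ {a b} (f : a ⟶ b) (j : Fin (F.obj a).arrow.arity) (j' : Fin (G.obj a).arrow.arity),
      (j : ℕ) = j' → (Labelled.Hom.perm (F.map f) j : ℕ) = Labelled.Hom.perm (G.map f) j')
    (h₄ : ∀ {a b} (f : a ⟶ b) (j : Fin (F.obj a).arrow.arity) (j' : Fin (G.obj a).arrow.arity),
      (j : ℕ) = j' → HEq (Labelled.Hom.map (F.map f) j) (Labelled.Hom.map (G.map f) j')) :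
    F = G :=
  CategoryTheory.Functor.hext (fun a => Labelled.obj_ext (h₁ a) (h₂ a)) fun _ _ f =>
    Labelled.hom_heq (Labelled.obj_ext (h₁ _) (h₂ _)) (Labelled.obj_ext (h₁ _) (h₂ _)) _ _
      (h₃ f) (h₄ f)

theorem map_comp_heq {C D : Type*} [Category C] [Category D] (F : C ⥤ D) {x y z : C} (f : x ⟶ y)
    (h : y = z) {w : D} (h' : F.obj y = w) : HEq (F.map f ≫ eqToHom h') (F.map (f ≫ eqToHom h)) := by
  subst h h'
  simp

theorem mult_naturality {X Y : CatOver I} (F : X ⟶ Y) :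
    T.labelMap (T.labelMap F) ≫ T.multHom Y = T.multHom X ≫ T.labelMap F := by
  refine CatOver.hom_ext (functor_ext (fun _ => rfl) ?_ ?_ ?_)
  · intro a j j' hj
    obtain rfl := Fin.ext hj
    rfl
  · intro a b f j j' hj
    obtain rfl := Fin.ext hj
    rfl
  · intro a b f j j' hj
    obtain rfl := Fin.ext hj
    exact map_comp_heq F.functor _ _ _

theorem mult_left_unit (X : CatOver I) : T.unitHom (T.label X) ≫ T.multHom X = 𝟙 _ := by
  refine CatOver.hom_ext (functor_ext ?_ ?_ ?_ ?_)
  · intro a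
    exact one_compArrow a.arrow fun _ => rfl
  · intro a j j' hj
    obtain rfl : (pos (m := fun _ : Fin 1 => a.arrow.arity) j).2 = j' :=
      Fin.ext ((pos_unit_left j).trans hj)
    rfl
  · intro a b f j j' hj
    exact blockPerm_unit_left (Labelled.Hom.perm f) j j' hj
  · intro a b f j j' hj
    obtain rfl : (pos (m := fun _ : Fin 1 => a.arrow.arity) j).2 = j' :=
      Fin.ext ((pos_unit_left j).trans hj)
    exact comp_eqToHom_heq _ _

theorem mult_right_unit (X : CatOver I) : T.labelMap (T.unitHom X) ≫ T.multHom X = 𝟙 _ := by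
  refine CatOver.hom_ext (functor_ext ?_ ?_ ?_ ?_)
  · intro a
    exact compArrow_one a.arrow _ fun j => congrArg Discrete.as (a.label j).2
  · intro a j j' hj
    obtain rfl : (pos (m := fun _ : Fin a.arrow.arity => 1) j).1 = j' :=
      Fin.ext ((pos_unit_right j).trans hj)
    rfl
  · intro a b f j j' hj
    exact blockPerm_unit_right (Labelled.Hom.perm f) j j' hj
  · intro a b f j j' hj
    obtain rfl : (pos (m := fun _ : Fin a.arrow.arity => 1) j).1 = j' :=
      Fin.ext ((pos_unit_right j).trans hj)
    exact comp_eqToHom_heq _ _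

theorem mult_assoc (X : CatOver I) :
    T.labelMap (T.multHom X) ≫ T.multHom X = T.multHom (T.label X) ≫ T.multHom X := by
  refine Eq.symm (CatOver.hom_ext (functor_ext ?_ ?_ ?_ ?_))
  · intro a
    exact compArrow_assoc a.arrow (fun j => (a.label j).1.arrow)
      (fun j => congrArg Discrete.as (a.label j).2)
      (fun j k => ((a.label j).1.label k).1.arrow)
      (fun j k => congrArg Discrete.as ((a.label j).1.label k).2)
  · intro a j j' hj
    have h := pos_assoc (m := fun j => (a.label j).1.arrow.arity)
      (p := fun j k => ((a.label j).1.label k).1.arrow.arity) j j' hj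
    exact congrArg (fun q : (j : Fin a.arrow.arity) × (k : Fin (a.label j).1.arrow.arity) ×
      Fin ((a.label j).1.label k).1.arrow.arity => (((a.label q.1).1.label q.2.1).1.label q.2.2).1) h
  · intro a b f j j' hj
    exact blockPerm_assoc (m' := fun j => (a.label j).1.arrow.arity)
      (p' := fun j k => ((a.label j).1.label k).1.arrow.arity)
      (m := fun j => (b.label j).1.arrow.arity)
      (p := fun j k => ((b.label j).1.label k).1.arrow.arity)
      (Labelled.Hom.perm f) (fun j => Labelled.Hom.perm (f.map j))
      (fun j k => Labelled.Hom.perm ((f.map j).map k))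
      (fun s => Labelled.Hom.perm ((multMap f).map s))
      (fun s l => Labelled.perm_comp_eqToHom ((f.map (pos s).1).map (pos s).2) _ l) j j' hj
  · intro a b f j j' hj
    have h := pos_assoc (m := fun j => (a.label j).1.arrow.arity)
      (p := fun j k => ((a.label j).1.label k).1.arrow.arity) j j' hj
    let G := fun q : (j : Fin a.arrow.arity) × (k : Fin (a.label j).1.arrow.arity) ×
      Fin ((a.label j).1.label k).1.arrow.arity => (((f.map q.1).map q.2.1).map q.2.2)
    have h1 : HEq ((multMap (multMap f)).map j)
        (G (coordL (p := fun j k => ((a.label j).1.label k).1.arrow.arity) j)) :=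
      (comp_eqToHom_heq _ _).trans
        (Labelled.map_comp_eqToHom ((f.map (pos (pos j).1).1).map (pos (pos j).1).2) _ (pos j).2)
    have h2 : HEq ((multMap ((T.labelMap (T.multHom X)).functor.map f)).map j')
        (G (coordR (p := fun j k => ((a.label j).1.label k).1.arrow.arity) j')) :=
      (comp_eqToHom_heq _ _).trans (comp_eqToHom_heq _ _)
    refine h1.trans (HEq.trans ?_ h2.symm)
    exact congr_arg_heq G h

theorem unit_naturality {X Y : CatOver I} (F : X ⟶ Y) :
    F ≫ T.unitHom Y = T.unitHom X ≫ T.labelMap F := by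
  refine CatOver.hom_ext (functor_ext ?_ ?_ ?_ ?_)
  · intro a
    exact congrArg (fun i => T.arrow (T.one i.as)) (Functor.congr_obj F.comm a)
  · intro _ _ _ _
    rfl
  · intro _ _ _ _ _ hj
    exact hj
  · intro _ _ _ _ _ _
    rfl

/-- The 2-monad on `Cat/I` of an operad with set of colours `I`. -/
def twoMonad (T : Operad I) : TwoMonad (CatOver I) where
  T := T.labelFunctor
  η := T.unitHom
  μ := T.multHom
  η_naturality := unit_naturality
  η_naturality₂ {X Y F G} φ := by
    refine CatOver.eq_eqToHom_comp _ _ _ _ fun x => ?_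
    refine Labelled.hom_heq (Functor.congr_obj (congrArg CatOver.Hom.functor (unit_naturality F)) x)
      (Functor.congr_obj (congrArg CatOver.Hom.functor (unit_naturality G)) x) _ _ ?_ ?_
    · intro _ _ hj
      exact hj
    · intro _ _ _
      rfl
  μ_naturality := mult_naturality
  μ_naturality₂ {X Y F G} φ := by
    refine CatOver.eq_eqToHom_comp _ _ _ _ fun x => ?_
    refine Labelled.hom_heq (Functor.congr_obj (congrArg CatOver.Hom.functor (mult_naturality F)) x)
      (Functor.congr_obj (congrArg CatOver.Hom.functor (mult_naturality G)) x) _ _ ?_ ?_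
    · intro j j' hj
      obtain rfl := Fin.ext hj
      exact congrArg Fin.val (blockPerm_refl _)
    · intro j j' hj
      obtain rfl := Fin.ext hj
      exact comp_eqToHom_heq _ _
  left_unit := mult_left_unit
  right_unit := mult_right_unit
  assoc := mult_assoc

end Operad

/-! ### The correspondence -/

namespace Operad

open Collection

variable {T : Operad I} {H : CatOver I}

/-- The labelled operation `(α, (x_j)_j)`. -/
def labelled {n : ℕ} {c : Fin n → I} {i : I} (α : T.Op c i) (x : ∀ j, H.Fib (c j)) :
    T.Labelled H :=
  ⟨T.arrow α, x⟩

/-- The levelwise morphism `(1, (f_j)_j) : (α, (x_j)_j) ⟶ (α, (y_j)_j)`. -/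
def levelwise {n : ℕ} {c : Fin n → I} {i : I} (α : T.Op c i) {x y : ∀ j, H.Fib (c j)}
    (f : x ⟶ y) : labelled α x ⟶ labelled α y :=
  ⟨𝟙 _, fun j => (f j).1⟩

/-- The permutative morphism `(ρ, (1)_j) : (αρ, (x_{ρj})_j) ⟶ (α, (x_j)_j)`. -/
def permutative {n m : ℕ} {c : Fin n → I} {i : I} (α : T.Op c i) (ρ : Fin m ≃ Fin n)
    (x : ∀ j, H.Fib (c j)) : labelled (T.act α ρ) (fun j => x (ρ j)) ⟶ labelled α x :=
  ⟨⟨ρ, rfl⟩, fun _ => 𝟙 _⟩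

/-- The operation `(α, (β_j, (x_{jk})_k)_j)` labelled by labelled operations. -/
def labelled₂ {n : ℕ} {c : Fin n → I} {i : I} (α : T.Op c i) {m : Fin n → ℕ}
    {d : ∀ j, Fin (m j) → I} (β : ∀ j, T.Op (d j) (c j)) (x : ∀ j k, H.Fib (d j k)) :
    T.Labelled (T.label H) :=
  ⟨T.arrow α, fun j => ⟨labelled (β j) (x j), rfl⟩⟩

/-- The action `TH ⟶ H` of a lax algebra, as a functor. -/
def action (A : LaxAlgebra T.twoMonad H) : T.Labelled H ⥤ H.carrier :=
  CatOver.Hom.functor A.act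

/-- The lax algebra structure `A` on `H` and the lax morphism structure `M` on the fibres of `H`
have the same data: the products and symmetries of `M` are the values of the action of `A` on
levelwise and on permutative morphisms, and the units and substitutions of `M` have the same
components as the coherence 2-cells of `A`. -/
structure Corresponds (A : LaxAlgebra T.twoMonad H) (M : LaxMorphism T H.Fib) : Prop where
  prod_obj : ∀ {n : ℕ} {c : Fin n → I} {i : I} (α : T.Op c i) (x : ∀ j, H.Fib (c j)),
    ((M.prod α).obj x).1 = (action A).obj (labelled α x)
  prod_map : ∀ {n : ℕ} {c : Fin n → I} {i : I} (α : T.Op c i) {x y : ∀ j, H.Fib (c j)}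
    (f : x ⟶ y), HEq ((M.prod α).map f).1 ((action A).map (levelwise α f))
  symm : ∀ {n m : ℕ} {c : Fin n → I} {i : I} (α : T.Op c i) (ρ : Fin m ≃ Fin n)
    (x : ∀ j, H.Fib (c j)),
    HEq ((M.symm α ρ).app x).1 ((action A).map (permutative α ρ x))
  unit : ∀ {i : I} (x : H.Fib i),
    HEq ((M.unit i).app x).1 ((CatOver.Hom₂.nat A.unit).app x.1)
  subst : ∀ {n : ℕ} {c : Fin n → I} {i : I} (α : T.Op c i) {m : Fin n → ℕ}
    {d : ∀ j, Fin (m j) → I} (β : ∀ j, T.Op (d j) (c j)) (x : ∀ j k, H.Fib (d j k)),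
    HEq ((M.subst α β).app x).1 ((CatOver.Hom₂.nat A.mult).app (labelled₂ α β x))

end Operad

end Polynomial

end PolyOperad

open PolyOperad

namespace PolyOperad

variable {I : Type u}

/-! Every morphism of `TH` over a permutation `ρ` factors as a levelwise morphism `(1, (f_j)_j)`
followed by a permutative one `(ρ, (1)_j)` (`exists_hom`). Hence a functor `a : TH ⟶ H` over `I`
amounts to its values on levelwise morphisms, which form the functors `H_α`, and on permutative
morphisms, which form the symmetries `ξ`. Functoriality of `a` then says that the `H_α` are
functors, that `ξ` is natural, and that `ξ_{α,1}` and `ξ_{α,ρτ}` are as prescribed.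

As `I` is discrete, every morphism of `H` lies in a fibre up to an equality of colours, so the unit
2-cell is the same as the family `ν_i`. A 2-cell `a T(a) ⟶ a μ` has one component for each `(α,
(β_j, (x_{jk})_k)_j)`. Applying the factorization both outside and inside splits its naturality into
two squares: the one for levelwise morphisms is naturality of `σ`, and the one for permutative
morphisms is compatibility of `σ` with `ξ`.

So the axioms of a lax morphism fall into two groups. Those that involve `ξ` (`IsSymmetric`) are
exactly what makes the data into functors and 2-cells. The unit and associativity axioms
(`IsCoherent`) are the components of the three lax algebra equations (`isCoherent_iff_isLax`).
Bijectivity is proved for data without the second group: `toMorphismData` is injective, and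
`toAlgebraData` is a section of it over symmetric data. Invertibility and being an identity are
tested on components.

Most of the remaining work concerns equalities of operations, such as `α1 = α` or associativity,
that hold only propositionally. They are handled by heterogeneous equality, or by first bringing an
object into a form where the equality is definitional. -/

theorem Functor.map_heq {C D : Type*} [Category C] [Category D] (F : C ⥤ D) {x y x' y' : C}
    {f : x ⟶ y} {g : x' ⟶ y'} (hx : x = x') (hy : y = y') (h : HEq f g) :
    HEq (F.map f) (F.map g) := by
  subst hx hy h
  rfl

theorem comp_heq {C : Type*} [Category C] {x y z x' y' z' : C} {f : x ⟶ y} {g : y ⟶ z}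
    {f' : x' ⟶ y'} {g' : y' ⟶ z'} (hx : x = x') (hy : y = y') (hz : z = z') (hf : HEq f f')
    (hg : HEq g g') : HEq (f ≫ g) (f' ≫ g') := by
  subst hx hy hz hf hg
  rfl

/-- Transports one edge of a naturality square along equalities of its endpoints. The unit `ν_i`
needs this, since the square for `A.unit` ends at a different expression for the unit operation. -/
theorem comp_eqToHom_eq_of_heq {C : Type*} [Category C] {a b p q p' q' : C} {f : a ⟶ b}
    {u : a ⟶ p} {v : b ⟶ q} {g : p ⟶ q} {g' : p' ⟶ q'} (h : f ≫ v = u ≫ g) (hg : HEq g g')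
    (hp : p = p') (hq : q = q') : f ≫ v ≫ eqToHom hq = (u ≫ eqToHom hp) ≫ g' := by
  subst hp hq hg
  simpa using h

/-! ### Morphisms in the fibres -/

namespace CatOver

/-- A morphism between objects of a fibre. -/
def fibHom {X : CatOver I} {i : I} {x y : X.Fib i} (f : x.1 ⟶ y.1) : x ⟶ y :=
  ⟨f, X.isHomLift x y f⟩

theorem fib_eqToHom_val {X : CatOver I} {i : I} {x y : X.Fib i} (h : x = y) :
    (eqToHom h).1 = eqToHom (congrArg Subtype.val h) := by
  subst h
  rfl

theorem fib_hom_ext_iff {X : CatOver I} {i : I} {x y : X.Fib i} {f g : x ⟶ y} :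
    f.1 = g.1 ↔ f = g :=
  Subtype.ext_iff.symm

end CatOver

/-! ### Structures without their axioms -/

/-- The data of a lax morphism of operads `T ⟶ Cat`, without the axioms. -/
structure MorphismData (T : Operad I) (H : I → Type u) [∀ i, Category.{u} (H i)] where
  /-- The products. -/
  prod : ∀ {n : ℕ} {c : Fin n → I} {i : I}, T.Op c i → ((∀ j, H (c j)) ⥤ H i)
  /-- The symmetries. -/
  symm : ∀ {n m : ℕ} {c : Fin n → I} {i : I} (α : T.Op c i) (ρ : Fin m ≃ Fin n),
    Pi.comap (fun j => H (c j)) ρ ⋙ prod (T.act α ρ) ⟶ prod α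
  /-- The units. -/
  unit : ∀ i : I, 𝟭 (H i) ⟶ Functor.pi' (fun _ : Fin 1 => 𝟭 (H i)) ⋙ prod (T.one i)
  /-- The substitutions. -/
  subst : ∀ {n : ℕ} {c : Fin n → I} {i : I} (α : T.Op c i) {m : Fin n → ℕ}
    {d : ∀ j, Fin (m j) → I} (β : ∀ j, T.Op (d j) (c j)),
    Functor.pi (fun j => prod (β j)) ⋙ prod α ⟶ flat H d ⋙ prod (T.comp α β)

/-- The data of a lax algebra for the 2-monad of an operad, without the axioms. -/
structure AlgebraData (T : Operad I) (H : CatOver I) where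
  /-- The action. -/
  act : T.label H ⟶ H
  /-- The unit coherence. -/
  unit : 𝟙 H ⟶ T.unitHom H ≫ act
  /-- The multiplication coherence. -/
  mult : T.labelMap act ≫ act ⟶ T.multHom H ≫ act

/-! ### Levelwise and permutative morphisms -/

namespace Operad

open Collection

variable {T : Operad I} {H : CatOver I}

theorem levelwise_id {n : ℕ} {c : Fin n → I} {i : I} (α : T.Op c i) (x : ∀ j, H.Fib (c j)) :
    levelwise α (𝟙 x) = 𝟙 (labelled α x) := rfl

/-- Both composites have permutation `ρ` and label morphisms `f (ρ j)`, up to identities. The action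
turns this square into naturality of `ξ_{α,ρ}`. -/
theorem permutative_naturality {n m : ℕ} {c : Fin n → I} {i : I} (α : T.Op c i)
    (ρ : Fin m ≃ Fin n) {x y : ∀ j, H.Fib (c j)} (f : x ⟶ y) :
    levelwise (T.act α ρ) (x := fun j => x (ρ j)) (y := fun j => y (ρ j)) (fun j => f (ρ j)) ≫
      permutative α ρ y = permutative α ρ x ≫ levelwise α f :=
  Labelled.Hom.ext' (fun _ => rfl) fun _ =>
    heq_of_eq ((Category.comp_id _).trans (Category.id_comp _).symm)

/-- The levelwise morphism of operations labelled by labelled operations. -/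
def levelwise₂ {n : ℕ} {c : Fin n → I} {i : I} (α : T.Op c i) {m : Fin n → ℕ}
    {d : ∀ j, Fin (m j) → I} (β : ∀ j, T.Op (d j) (c j)) {x y : ∀ j k, H.Fib (d j k)}
    (f : x ⟶ y) : labelled₂ α β x ⟶ labelled₂ α β y :=
  ⟨𝟙 _, fun j => levelwise (β j) (f j)⟩

/-- No position moves, so the block permutation is trivial and only the labels are concatenated.
This identifies the target side of the naturality square of `σ`. -/
theorem multMap_levelwise₂ {n : ℕ} {c : Fin n → I} {i : I} (α : T.Op c i) {m : Fin n → ℕ}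
    {d : ∀ j, Fin (m j) → I} (β : ∀ j, T.Op (d j) (c j)) {x y : ∀ j k, H.Fib (d j k)}
    (f : x ⟶ y) : multMap (levelwise₂ α β f) =
      levelwise (T.comp α β) ((flat (fun i => H.Fib i) d).map f) :=
  Labelled.Hom.ext' blockPerm_refl fun _ => comp_eqToHom_heq _ _

/-- The unit operation on the left has the colour of `x.1`, which equals `i` only propositionally;
after substitution the two sides coincide. -/
theorem unitHom_obj {i : I} (x : H.Fib i) :
    (T.unitHom H).functor.obj x.1 = labelled (T.one i) (fun _ => x) := by
  obtain ⟨x, h⟩ := x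
  obtain rfl : H.colour x = i := congrArg Discrete.as h
  rfl

theorem unitHom_map {i : I} {x y : H.Fib i} (f : x ⟶ y) :
    HEq ((T.unitHom H).functor.map f.1)
      (levelwise (T.one i) (x := fun _ => x) (y := fun _ => y) (fun _ => f)) :=
  Labelled.hom_heq (unitHom_obj x) (unitHom_obj y) _ _ (fun _ _ h => h) fun _ _ _ => HEq.rfl

end Operad

/-! ### From lax algebras to lax morphisms: the data -/

namespace AlgebraData

open Operad Collection

variable {T : Operad I} {H : CatOver I} (A : AlgebraData T H)

/-- The action on labelled operations with target `i`. -/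
def actFib {n : ℕ} {c : Fin n → I} {i : I} (α : T.Op c i) (x : ∀ j, H.Fib (c j)) : H.Fib i :=
  ⟨(CatOver.Hom.functor A.act).obj (labelled α x),
    Functor.congr_obj (CatOver.Hom.comm A.act) (labelled α x)⟩

/-- The data of a lax morphism given by the data of a lax algebra. -/
def toMorphismData : MorphismData T (fun i => H.Fib i) where
  prod α :=
    { obj := A.actFib α
      map := fun f => CatOver.fibHom ((CatOver.Hom.functor A.act).map (levelwise α f))
      map_id := fun _ => Subtype.ext ((CatOver.Hom.functor A.act).map_id _)
      map_comp := fun f g => Subtype.ext ((CatOver.Hom.functor A.act).map_comp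
        (levelwise α f) (levelwise α g)) }
  symm α ρ :=
    { app := fun x => CatOver.fibHom ((CatOver.Hom.functor A.act).map (permutative α ρ x))
      naturality := fun x y f => Subtype.ext <|
        ((CatOver.Hom.functor A.act).map_comp _ _).symm.trans <|
          (congrArg (CatOver.Hom.functor A.act).map (permutative_naturality α ρ f)).trans
            ((CatOver.Hom.functor A.act).map_comp _ _) }
  unit i :=
    -- The component of `A.unit` ends at the unit arrow of the colour of `x.1`; the `eqToHom` moves
    -- it to `1_i`.
    { app := fun x => CatOver.fibHom ((CatOver.Hom₂.nat A.unit).app x.1 ≫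
        eqToHom (congrArg (CatOver.Hom.functor A.act).obj (unitHom_obj x)))
      naturality := fun x y f => Subtype.ext <| by
        exact comp_eqToHom_eq_of_heq ((CatOver.Hom₂.nat A.unit).naturality f.1)
          (Functor.map_heq (CatOver.Hom.functor A.act) (unitHom_obj x) (unitHom_obj y)
            (unitHom_map f)) _ _ }
  subst α _ _ β :=
    -- No correction is needed here: `multObj (labelled₂ α β x)` is definitionally the composite
    -- operation with concatenated labels.
    { app := fun x => CatOver.fibHom ((CatOver.Hom₂.nat A.mult).app (labelled₂ α β x))
      naturality := fun x y f => Subtype.ext <|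
        ((CatOver.Hom₂.nat A.mult).naturality (levelwise₂ α β f)).trans <|
          congrArg (fun g => (CatOver.Hom₂.nat A.mult).app (labelled₂ α β x) ≫
            (CatOver.Hom.functor A.act).map g) (multMap_levelwise₂ α β f) }

end AlgebraData

/-! ### The lax algebra axioms on components -/

theorem comp_heq_id_iff {C : Type*} [Category C] {x y z w : C} (u : x ⟶ y) (h : y = z)
    (v : z ⟶ w) (k : w = x) :
    HEq (u ≫ eqToHom h ≫ v) (𝟙 x) ↔ (u ≫ eqToHom h) ≫ v ≫ eqToHom k = 𝟙 x := by
  subst h k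
  simp

theorem comp_heq_comp_iff {C : Type*} [Category C] {x y z w y' z' w' : C} (u : x ⟶ y) (h : y = z)
    (v : z ⟶ w) (u' : x ⟶ y') (h' : y' = z') (v' : z' ⟶ w') (k : w = w') :
    HEq (u ≫ eqToHom h ≫ v) (u' ≫ eqToHom h' ≫ v') ↔
      u ≫ eqToHom h ≫ v ≫ eqToHom k = u' ≫ eqToHom h' ≫ v' := by
  subst h h' k
  simp

namespace CatOver

/-- 2-cells over `I` are equal when their components are. With `HEq`, the outer identity 2-cell need
not be evaluated on components. -/
theorem comp_eq_eqToHom_iff_app {X Y : CatOver I} {F G G' K : X ⟶ Y} (φ : F ⟶ G) (h : G = G')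
    (ψ : G' ⟶ K) (k : F = K) : φ ≫ eqToHom h ≫ ψ = eqToHom k ↔
      ∀ x (h' : (Hom.functor G).obj x = (Hom.functor G').obj x),
        HEq ((Hom₂.nat φ).app x ≫ eqToHom h' ≫ (Hom₂.nat ψ).app x) (𝟙 ((Hom.functor F).obj x)) := by
  subst h k
  simp only [eqToHom_refl, Category.id_comp, heq_eq_eq]
  exact ⟨fun h x _ => congrArg (fun φ : F ⟶ F => (Hom₂.nat φ).app x) h,
    fun h => hom₂_ext (NatTrans.ext (funext fun x => h x trivial))⟩

theorem comp_eq_comp_iff_app {X Y : CatOver I} {F G G' K F' L L' K' : X ⟶ Y} (φ : F ⟶ G)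
    (h : G = G') (ψ : G' ⟶ K) (φ' : F' ⟶ L) (h' : L = L') (ψ' : L' ⟶ K') (k : F = F')
    (l : K' = K) :
    φ ≫ eqToHom h ≫ ψ = eqToHom k ≫ φ' ≫ eqToHom h' ≫ ψ' ≫ eqToHom l ↔
      ∀ x (k : (Hom.functor G).obj x = (Hom.functor G').obj x)
        (k' : (Hom.functor L).obj x = (Hom.functor L').obj x),
        HEq ((Hom₂.nat φ).app x ≫ eqToHom k ≫ (Hom₂.nat ψ).app x)
          ((Hom₂.nat φ').app x ≫ eqToHom k' ≫ (Hom₂.nat ψ').app x) := by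
  subst h h' k l
  simp only [eqToHom_refl, Category.id_comp, Category.comp_id, heq_eq_eq]
  exact ⟨fun h x _ _ => congrArg (fun φ : F ⟶ K' => (Hom₂.nat φ).app x) h,
    fun h => hom₂_ext (NatTrans.ext (funext fun x => h x trivial trivial))⟩

end CatOver

namespace AlgebraData

open Operad Collection

variable {T : Operad I} {H : CatOver I} (A : AlgebraData T H)

/-- The axioms of a lax algebra, on components. -/
structure IsLax : Prop where
  unit_left : ∀ (a : T.Labelled H) h, HEq
    ((CatOver.Hom₂.nat A.unit).app ((CatOver.Hom.functor A.act).obj a) ≫ eqToHom h ≫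
      (CatOver.Hom₂.nat A.mult).app ((T.unitHom (T.label H)).functor.obj a))
    (𝟙 ((CatOver.Hom.functor A.act).obj a))
  unit_right : ∀ (a : T.Labelled H) h, HEq
    ((CatOver.Hom.functor A.act).map ((CatOver.Hom₂.nat (T.labelMap₂ A.unit)).app a) ≫
      eqToHom h ≫ (CatOver.Hom₂.nat A.mult).app ((T.labelMap (T.unitHom H)).functor.obj a))
    (𝟙 ((CatOver.Hom.functor A.act).obj a))
  assoc : ∀ (a : T.Labelled (T.label (T.label H))) h h', HEq
    ((CatOver.Hom₂.nat A.mult).app ((T.labelMap (T.labelMap A.act)).functor.obj a) ≫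
      eqToHom h ≫ (CatOver.Hom₂.nat A.mult).app ((T.multHom (T.label H)).functor.obj a))
    ((CatOver.Hom.functor A.act).map ((CatOver.Hom₂.nat (T.labelMap₂ A.mult)).app a) ≫
      eqToHom h' ≫ (CatOver.Hom₂.nat A.mult).app ((T.labelMap (T.multHom H)).functor.obj a))

/-- The data of a lax algebra. -/
def ofLaxAlgebra (L : LaxAlgebra T.twoMonad H) : AlgebraData T H := ⟨L.act, L.unit, L.mult⟩

theorem ofLaxAlgebra_injective :
    Function.Injective (ofLaxAlgebra : LaxAlgebra T.twoMonad H → AlgebraData T H) := by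
  rintro ⟨⟩ ⟨⟩ h
  cases h
  rfl

theorem isLax_ofLaxAlgebra (L : LaxAlgebra T.twoMonad H) : (ofLaxAlgebra L).IsLax where
  unit_left := (CatOver.comp_eq_eqToHom_iff_app _ _ _ _).1 L.unit_left
  unit_right := (CatOver.comp_eq_eqToHom_iff_app _ _ _ _).1 L.unit_right
  assoc := (CatOver.comp_eq_comp_iff_app _ _ _ _ _ _ _ _).1 L.assoc

/-- The lax algebra with the given data. -/
def toLaxAlgebra (hA : A.IsLax) : LaxAlgebra T.twoMonad H where
  act := A.act
  unit := A.unit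
  mult := A.mult
  unit_left := (CatOver.comp_eq_eqToHom_iff_app _ _ _ _).2 hA.unit_left
  unit_right := (CatOver.comp_eq_eqToHom_iff_app _ _ _ _).2 hA.unit_right
  assoc := (CatOver.comp_eq_comp_iff_app _ _ _ _ _ _ _ _).2 hA.assoc

end AlgebraData

/-! ### The two groups of axioms of a lax morphism -/

namespace MorphismData

variable {T : Operad I} {H : I → Type u} [∀ i, Category.{u} (H i)]

/-- The axioms of a lax morphism on the symmetries. -/
structure IsSymmetric (M : MorphismData T H) : Prop where
  symm_refl : ∀ {n : ℕ} {c : Fin n → I} {i : I} (α : T.Op c i) (x : ∀ j, H (c j)),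
    (M.symm α (Equiv.refl _)).app x =
      eqToHom (congrArg (fun β => (M.prod β).obj x) (T.act_refl α))
  symm_trans : ∀ {n m l : ℕ} {c : Fin n → I} {i : I} (α : T.Op c i) (ρ : Fin m ≃ Fin n)
    (τ : Fin l ≃ Fin m) (x : ∀ j, H (c j)),
    (M.symm α (τ.trans ρ)).app x =
      eqToHom (congrArg (fun β => (M.prod β).obj (fun j => x (ρ (τ j)))) (T.act_act α ρ τ).symm) ≫
        (M.symm (T.act α ρ) τ).app (fun j => x (ρ j)) ≫ (M.symm α ρ).app x
  subst_symm : ∀ {n n' : ℕ} {c : Fin n → I} {i : I} (α : T.Op c i) {m : Fin n → ℕ}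
    {d : ∀ j, Fin (m j) → I} (β : ∀ j, T.Op (d j) (c j)) (ρ : Fin n' ≃ Fin n) {m' : Fin n' → ℕ}
    (ρs : ∀ j, Fin (m' j) ≃ Fin (m (ρ j))) (x : ∀ j k, H (d j k)),
    (M.prod (T.act α ρ)).map (fun j => (M.symm (β (ρ j)) (ρs j)).app (x (ρ j))) ≫
        (M.symm α ρ).app (fun j => (M.prod (β j)).obj (x j)) ≫ (M.subst α β).app x =
      (M.subst (T.act α ρ) fun j => T.act (β (ρ j)) (ρs j)).app (fun j k => x (ρ j) (ρs j k)) ≫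
        eqToHom (obj_congr M.prod (T.equivariance α β ρ ρs).symm _ _ (flat_blockPerm ρ ρs x)) ≫
        (M.symm (T.comp α β) (blockPerm ρ ρs)).app ((flat H d).obj x)

/-- The axioms of a lax morphism on units and substitutions only. -/
structure IsCoherent (M : MorphismData T H) : Prop where
  unit_right : ∀ {n : ℕ} {c : Fin n → I} {i : I} (α : T.Op c i) (x : ∀ j, H (c j)),
    (M.prod α).map (fun j => (M.unit (c j)).app (x j)) ≫
        (M.subst α fun j => T.one (c j)).app (fun j _ => x j) ≫
        eqToHom (obj_congr M.prod (T.comp_one α) _ _ (flat_unit_right x)) =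
      𝟙 ((M.prod α).obj x)
  unit_left : ∀ {n : ℕ} {c : Fin n → I} {i : I} (α : T.Op c i) (x : ∀ j, H (c j)),
    (M.unit i).app ((M.prod α).obj x) ≫
        (M.subst (T.one i) fun _ => α).app (fun _ => x) ≫
        eqToHom (obj_congr M.prod (T.one_comp α) _ _ (flat_unit_left x)) =
      𝟙 ((M.prod α).obj x)
  assoc : ∀ {n : ℕ} {c : Fin n → I} {i : I} (α : T.Op c i) {m : Fin n → ℕ}
    {d : ∀ j, Fin (m j) → I} (β : ∀ j, T.Op (d j) (c j)) {p : ∀ j, Fin (m j) → ℕ}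
    {e : ∀ j k, Fin (p j k) → I} (γ : ∀ j k, T.Op (e j k) (d j k)) (x : ∀ j k l, H (e j k l)),
    (M.subst α β).app (fun j k => (M.prod (γ j k)).obj (x j k)) ≫
        (M.subst (T.comp α β) fun t => γ (pos t).1 (pos t).2).app
          (fun t => x (pos t).1 (pos t).2) ≫
        eqToHom (obj_congr M.prod (T.assoc α β γ) _ _ (flat_flat x)) =
      (M.prod α).map (fun j => (M.subst (β j) (γ j)).app (x j)) ≫
        (M.subst α fun j => T.comp (β j) (γ j)).app (fun j => (flat H (e j)).obj (x j))

/-- The data of a lax morphism. -/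
def ofLaxMorphism (L : LaxMorphism T H) : MorphismData T H := ⟨L.prod, L.symm, L.unit, L.subst⟩

theorem ofLaxMorphism_injective :
    Function.Injective (ofLaxMorphism : LaxMorphism T H → MorphismData T H) := by
  rintro ⟨p, s, v, t⟩ ⟨p', s', v', t'⟩ h
  obtain ⟨h₁, h₂, h₃, h₄⟩ := MorphismData.mk.inj h
  obtain rfl : @p = @p' := h₁
  obtain rfl : @s = @s' := eq_of_heq h₂
  obtain rfl : @v = @v' := eq_of_heq h₃
  obtain rfl : @t = @t' := eq_of_heq h₄
  rfl

theorem isSymmetric_ofLaxMorphism (L : LaxMorphism T H) : (ofLaxMorphism L).IsSymmetric :=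
  ⟨L.symm_refl, L.symm_trans, L.subst_symm⟩

theorem isCoherent_ofLaxMorphism (L : LaxMorphism T H) : (ofLaxMorphism L).IsCoherent :=
  ⟨L.unit_right, L.unit_left, L.subst_assoc⟩

/-- The lax morphism with the given data. -/
def toLaxMorphism (M : MorphismData T H) (hs : M.IsSymmetric) (hc : M.IsCoherent) :
    LaxMorphism T H where
  prod := M.prod
  symm := M.symm
  unit := M.unit
  subst := M.subst
  symm_refl := hs.symm_refl
  symm_trans := hs.symm_trans
  unit_right := hc.unit_right
  unit_left := hc.unit_left
  subst_symm := hs.subst_symm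
  subst_assoc := hc.assoc

end MorphismData

/-! ### Normal forms for iterated labelled operations -/

namespace Operad

open Collection

variable {T : Operad I} {H : CatOver I}

/-- Operations labelled by operations labelled by labelled operations. -/
def labelled₃ {n : ℕ} {c : Fin n → I} {i : I} (α : T.Op c i) {m : Fin n → ℕ}
    {d : ∀ j, Fin (m j) → I} (β : ∀ j, T.Op (d j) (c j)) {p : ∀ j, Fin (m j) → ℕ}
    {e : ∀ j k, Fin (p j k) → I} (γ : ∀ j k, T.Op (e j k) (d j k))
    (x : ∀ j k l, H.Fib (e j k l)) : T.Labelled (T.label (T.label H)) :=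
  ⟨T.arrow α, fun j => ⟨labelled₂ (β j) (γ j) (x j), rfl⟩⟩

/-- An inner operation carries a proof that its target is the colour of its input. Once the colours
are replaced by these targets, the proof becomes `rfl`, as `labelled₂` requires. -/
theorem exists_labelled₂ (a : T.Labelled (T.label H)) : ∃ (n : ℕ) (c : Fin n → I) (i : I)
    (α : T.Op c i) (m : Fin n → ℕ) (d : ∀ j, Fin (m j) → I) (β : ∀ j, T.Op (d j) (c j))
    (x : ∀ j k, H.Fib (d j k)), a = labelled₂ α β x := by
  obtain ⟨⟨n, c, i, α⟩, y⟩ := a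
  obtain ⟨z, hz, rfl⟩ : ∃ (z : Fin n → T.Labelled H) (hz : ∀ j, (T.label H).proj.obj (z j) = ⟨c j⟩),
    y = fun j => ⟨z j, hz j⟩ := ⟨fun j => (y j).1, fun j => (y j).2, rfl⟩
  obtain rfl : (fun j => (z j).arrow.tgt) = c := funext fun j => congrArg Discrete.as (hz j)
  exact ⟨n, _, i, α, _, _, fun j => (z j).arrow.op, fun j => (z j).label, rfl⟩

/-- The normal form is applied to the outer two layers, and the same substitution of colours by
targets is repeated on the innermost labels. -/
theorem exists_labelled₃ (a : T.Labelled (T.label (T.label H))) : ∃ (n : ℕ) (c : Fin n → I) (i : I)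
    (α : T.Op c i) (m : Fin n → ℕ) (d : ∀ j, Fin (m j) → I) (β : ∀ j, T.Op (d j) (c j))
    (p : ∀ j, Fin (m j) → ℕ)
    (e : ∀ j k, Fin (p j k) → I) (γ : ∀ j k, T.Op (e j k) (d j k))
    (x : ∀ j k l, H.Fib (e j k l)), a = labelled₃ α β γ x := by
  obtain ⟨n, c, i, α, m, d, β, x, rfl⟩ := exists_labelled₂ a
  obtain ⟨z, hz, rfl⟩ : ∃ (z : ∀ j, Fin (m j) → T.Labelled H)
      (hz : ∀ j k, (T.label H).proj.obj (z j k) = ⟨d j k⟩), x = fun j k => ⟨z j k, hz j k⟩ :=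
    ⟨fun j k => (x j k).1, fun j k => (x j k).2, rfl⟩
  obtain rfl : (fun j k => (z j k).arrow.tgt) = d :=
    funext fun j => funext fun k => congrArg Discrete.as (hz j k)
  exact ⟨n, _, i, α, _, _, β, _, _, fun j k => (z j k).arrow.op, fun j k => (z j k).label, rfl⟩

end Operad

/-! ### Matching the unit and associativity axioms -/

namespace AlgebraData

open Operad Collection

variable {T : Operad I} {H : CatOver I} (A : AlgebraData T H)

theorem unit_left_iff {n : ℕ} {c : Fin n → I} {i : I} (α : T.Op c i) (x : ∀ j, H.Fib (c j)) h :
    HEq ((CatOver.Hom₂.nat A.unit).app ((CatOver.Hom.functor A.act).obj (labelled α x)) ≫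
      eqToHom h ≫
      (CatOver.Hom₂.nat A.mult).app ((T.unitHom (T.label H)).functor.obj (labelled α x)))
    (𝟙 ((CatOver.Hom.functor A.act).obj (labelled α x))) ↔
    (A.toMorphismData.unit i).app ((A.toMorphismData.prod α).obj x) ≫
        (A.toMorphismData.subst (T.one i) fun _ => α).app (fun _ => x) ≫
        eqToHom (obj_congr A.toMorphismData.prod (T.one_comp α) _ _ (flat_unit_left x)) =
      𝟙 ((A.toMorphismData.prod α).obj x) := by
  have h₁ := obj_congr A.toMorphismData.prod (T.one_comp α) _ _ (flat_unit_left x)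
  refine Iff.trans ?_ CatOver.fib_hom_ext_iff
  refine (comp_heq_id_iff _ _ _ (congrArg Subtype.val h₁)).trans (Eq.congr ?_ rfl)
  exact congrArg (_ ≫ _ ≫ ·) (CatOver.fib_eqToHom_val h₁).symm

theorem unit_right_iff {n : ℕ} {c : Fin n → I} {i : I} (α : T.Op c i) (x : ∀ j, H.Fib (c j)) h :
    HEq ((CatOver.Hom.functor A.act).map
        ((CatOver.Hom₂.nat (T.labelMap₂ A.unit)).app (labelled α x)) ≫
      eqToHom h ≫ (CatOver.Hom₂.nat A.mult).app
        ((T.labelMap (T.unitHom H)).functor.obj (labelled α x)))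
    (𝟙 ((CatOver.Hom.functor A.act).obj (labelled α x))) ↔
    (A.toMorphismData.prod α).map (fun j => (A.toMorphismData.unit (c j)).app (x j)) ≫
        (A.toMorphismData.subst α fun j => T.one (c j)).app (fun j _ => x j) ≫
        eqToHom (obj_congr A.toMorphismData.prod (T.comp_one α) _ _ (flat_unit_right x)) =
      𝟙 ((A.toMorphismData.prod α).obj x) := by
  obtain ⟨z, hz, rfl⟩ : ∃ (z : Fin n → H.carrier) (hz : ∀ j, H.proj.obj (z j) = ⟨c j⟩),
    x = fun j => ⟨z j, hz j⟩ := ⟨fun j => (x j).1, fun j => (x j).2, rfl⟩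
  -- With each `c j` literally the colour of its label, the `eqToHom` inside every `ν` is an
  -- identity.
  obtain rfl : (fun j => H.colour (z j)) = c := funext fun j => congrArg Discrete.as (hz j)
  have h₁ := obj_congr A.toMorphismData.prod (T.comp_one α) _ _
    (flat_unit_right fun j => H.inFib (z j))
  refine Iff.trans ?_ CatOver.fib_hom_ext_iff
  refine (comp_heq_id_iff _ _ _ (congrArg Subtype.val h₁)).trans (Eq.congr ?_ rfl)
  refine congr (congrArg (· ≫ ·) ?_) (congrArg (_ ≫ ·) (CatOver.fib_eqToHom_val h₁).symm)
  refine (Category.comp_id _).trans (congrArg (CatOver.Hom.functor A.act).map ?_)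
  exact Labelled.Hom.ext' (fun _ => rfl) fun j => heq_of_eq (Category.comp_id _).symm

/-- Both connecting equalities hold definitionally on such objects, so their `eqToHom`s disappear;
only the identification `h₁` coming from associativity of `T` survives. -/
theorem assoc_iff {n : ℕ} {c : Fin n → I} {i : I} (α : T.Op c i) {m : Fin n → ℕ}
    {d : ∀ j, Fin (m j) → I} (β : ∀ j, T.Op (d j) (c j)) {p : ∀ j, Fin (m j) → ℕ}
    {e : ∀ j k, Fin (p j k) → I} (γ : ∀ j k, T.Op (e j k) (d j k)) (x : ∀ j k l, H.Fib (e j k l))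
    h h' :
    HEq ((CatOver.Hom₂.nat A.mult).app
          ((T.labelMap (T.labelMap A.act)).functor.obj (labelled₃ α β γ x)) ≫
        eqToHom h ≫ (CatOver.Hom₂.nat A.mult).app
          ((T.multHom (T.label H)).functor.obj (labelled₃ α β γ x)))
      ((CatOver.Hom.functor A.act).map
          ((CatOver.Hom₂.nat (T.labelMap₂ A.mult)).app (labelled₃ α β γ x)) ≫
        eqToHom h' ≫ (CatOver.Hom₂.nat A.mult).app
          ((T.labelMap (T.multHom H)).functor.obj (labelled₃ α β γ x))) ↔
    (A.toMorphismData.subst α β).app (fun j k => (A.toMorphismData.prod (γ j k)).obj (x j k)) ≫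
        (A.toMorphismData.subst (T.comp α β) fun t => γ (pos t).1 (pos t).2).app
          (fun t => x (pos t).1 (pos t).2) ≫
        eqToHom (obj_congr A.toMorphismData.prod (T.assoc α β γ) _ _ (flat_flat x)) =
      (A.toMorphismData.prod α).map (fun j => (A.toMorphismData.subst (β j) (γ j)).app (x j)) ≫
        (A.toMorphismData.subst α fun j => T.comp (β j) (γ j)).app
          (fun j => (flat (fun i => H.Fib i) (e j)).obj (x j)) := by
  have h₁ := obj_congr A.toMorphismData.prod (T.assoc α β γ) _ _ (flat_flat x)
  refine Iff.trans ?_ CatOver.fib_hom_ext_iff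
  refine (comp_heq_comp_iff _ _ _ _ _ _ (congrArg Subtype.val h₁)).trans (Eq.congr ?_ ?_)
  · refine congrArg (_ ≫ ·) ((Category.id_comp _).trans ?_)
    exact congrArg (_ ≫ ·) (CatOver.fib_eqToHom_val h₁).symm
  · exact congrArg (_ ≫ ·) (Category.id_comp _)

theorem isCoherent_iff_isLax : A.toMorphismData.IsCoherent ↔ A.IsLax := by
  constructor
  · intro h
    refine ⟨fun a k => ?_, fun a k => ?_, fun a k k' => ?_⟩
    · exact (A.unit_left_iff a.arrow.op a.label k).2 (h.unit_left _ _)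
    · exact (A.unit_right_iff a.arrow.op a.label k).2 (h.unit_right _ _)
    · obtain ⟨n, c, i, α, m, d, β, p, e, γ, x, rfl⟩ := exists_labelled₃ a
      exact (A.assoc_iff α β γ x k k').2 (h.assoc _ _ _ _)
  · intro h
    refine ⟨fun α x => ?_, fun α x => ?_, fun α _ _ β _ _ γ x => ?_⟩
    · exact (A.unit_right_iff α x rfl).1 (h.unit_right _ _)
    · have k := congrArg (CatOver.Hom.functor A.act).obj (Functor.congr_obj
        (congrArg CatOver.Hom.functor (unit_naturality A.act)) (labelled α x))
      exact (A.unit_left_iff α x k).1 (h.unit_left _ _)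
    · exact (A.assoc_iff α β γ x rfl rfl).1 (h.assoc _ _ _)

end AlgebraData

/-! ### Factorization of morphisms of labelled operations -/

theorem eq_eqToHom_of_heq {C : Type*} [Category C] {x y : C} {f : x ⟶ y} (h : x = y)
    (hf : HEq f (𝟙 x)) : f = eqToHom h := by
  subst h
  exact eq_of_heq hf

theorem eq_eqToHom_comp_of_heq {C : Type*} [Category C] {x y z : C} {f : x ⟶ z} {g : y ⟶ z}
    (h : x = y) (hf : HEq f g) : f = eqToHom h ≫ g := by
  subst h
  exact (eq_of_heq hf).trans (Category.id_comp _).symm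

namespace Operad

open Collection

variable {T : Operad I} {H : CatOver I}

theorem permutative_refl {n : ℕ} {c : Fin n → I} {i : I} (α : T.Op c i) (x : ∀ j, H.Fib (c j)) :
    permutative α (Equiv.refl _) x =
      eqToHom (congrArg (fun β => labelled β x) (T.act_refl α)) := by
  refine eq_eqToHom_of_heq _ (Labelled.hom_heq rfl
    (congrArg (fun β => labelled β x) (T.act_refl α)).symm _ _ (fun _ _ h => h) fun j j' h => ?_)
  obtain rfl := Fin.ext h
  rfl

/-- The `eqToHom` is there because `(αρ)τ = α(ρτ)` is an equation between operations. The action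
turns this identity into the composition axiom for `ξ`. -/
theorem permutative_trans {n m l : ℕ} {c : Fin n → I} {i : I} (α : T.Op c i) (ρ : Fin m ≃ Fin n)
    (τ : Fin l ≃ Fin m) (x : ∀ j, H.Fib (c j)) :
    permutative α (τ.trans ρ) x =
      eqToHom (congrArg (fun β => labelled β (fun j => x (ρ (τ j)))) (T.act_act α ρ τ).symm) ≫
        permutative (T.act α ρ) τ (fun j => x (ρ j)) ≫ permutative α ρ x := by
  refine eq_eqToHom_comp_of_heq _ (Labelled.hom_heq
    (congrArg (fun β => labelled β (fun j => x (ρ (τ j)))) (T.act_act α ρ τ).symm) rfl _ _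
    (fun j j' h => ?_) fun j j' h => ?_)
  · obtain rfl := Fin.ext h
    rfl
  · obtain rfl := Fin.ext h
    exact heq_of_eq (Category.comp_id _).symm

/-- The permutative morphism of operations labelled by labelled operations. -/
def permutative₂ {n n' : ℕ} {c : Fin n → I} {i : I} (α : T.Op c i) {m : Fin n → ℕ}
    {d : ∀ j, Fin (m j) → I} (β : ∀ j, T.Op (d j) (c j)) (ρ : Fin n' ≃ Fin n) {m' : Fin n' → ℕ}
    (ρs : ∀ j, Fin (m' j) ≃ Fin (m (ρ j))) (x : ∀ j k, H.Fib (d j k)) :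
    labelled₂ (T.act α ρ) (fun j => T.act (β (ρ j)) (ρs j)) (fun j k => x (ρ j) (ρs j k)) ⟶
      labelled₂ α β x :=
  ⟨⟨ρ, rfl⟩, fun j => permutative (β (ρ j)) (ρs j) (x (ρ j))⟩

/-- Equivariance of operadic composition identifies the operations, and `pos_blockPerm` identifies
the labels. -/
theorem multObj_permutative₂ {n n' : ℕ} {c : Fin n → I} {i : I} (α : T.Op c i) {m : Fin n → ℕ}
    {d : ∀ j, Fin (m j) → I} (β : ∀ j, T.Op (d j) (c j)) (ρ : Fin n' ≃ Fin n) {m' : Fin n' → ℕ}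
    (ρs : ∀ j, Fin (m' j) ≃ Fin (m (ρ j))) (x : ∀ j k, H.Fib (d j k)) :
    multObj (labelled₂ (T.act α ρ) (fun j => T.act (β (ρ j)) (ρs j))
        (fun j k => x (ρ j) (ρs j k))) =
      labelled (T.act (T.comp α β) (blockPerm ρ ρs))
        (fun t => (flat (fun i => H.Fib i) d).obj x (blockPerm ρ ρs t)) := by
  refine Labelled.obj_ext (T.equivariance α β ρ ρs).symm fun t t' h => ?_
  obtain rfl := Fin.ext h
  exact congrArg (fun q : (j : Fin n) × Fin (m j) => (x q.1 q.2).1) (pos_blockPerm ρ ρs t).symm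

/-- All label morphisms are identities, so only the block permutation remains. Under the action this
yields the leg of the axiom `subst_symm` that substitutes before permuting. -/
theorem multMap_permutative₂ {n n' : ℕ} {c : Fin n → I} {i : I} (α : T.Op c i) {m : Fin n → ℕ}
    {d : ∀ j, Fin (m j) → I} (β : ∀ j, T.Op (d j) (c j)) (ρ : Fin n' ≃ Fin n) {m' : Fin n' → ℕ}
    (ρs : ∀ j, Fin (m' j) ≃ Fin (m (ρ j))) (x : ∀ j k, H.Fib (d j k)) :
    multMap (permutative₂ α β ρ ρs x) = eqToHom (multObj_permutative₂ α β ρ ρs x) ≫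
      permutative (T.comp α β) (blockPerm ρ ρs) ((flat (fun i => H.Fib i) d).obj x) := by
  refine eq_eqToHom_comp_of_heq _ (Labelled.hom_heq (multObj_permutative₂ α β ρ ρs x) rfl _ _
    (fun t t' h => ?_) fun t t' h => ?_)
  · obtain rfl := Fin.ext h
    rfl
  · obtain rfl := Fin.ext h
    refine (comp_eqToHom_heq _ _).trans ?_
    exact congr_arg_heq (fun q : (j : Fin n) × Fin (m j) => 𝟙 (x q.1 q.2).1)
      (pos_blockPerm ρ ρs t).symm

/-- The other leg of `subst_symm`: the inner permutations become label morphisms under `F`, and the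
outer permutation follows. -/
theorem labelMap_permutative₂ {X : CatOver I} (F : T.label H ⟶ X) {n n' : ℕ} {c : Fin n → I}
    {i : I} (α : T.Op c i) {m : Fin n → ℕ} {d : ∀ j, Fin (m j) → I} (β : ∀ j, T.Op (d j) (c j))
    (ρ : Fin n' ≃ Fin n) {m' : Fin n' → ℕ} (ρs : ∀ j, Fin (m' j) ≃ Fin (m (ρ j)))
    (x : ∀ j k, H.Fib (d j k)) :
    (T.labelMap F).functor.map (permutative₂ α β ρ ρs x) =
      levelwise (T.act α ρ)
          (x := fun j => CatOver.Hom.onFib F ⟨labelled (T.act (β (ρ j)) (ρs j)) _, rfl⟩)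
          (y := fun j => CatOver.Hom.onFib F ⟨labelled (β (ρ j)) _, rfl⟩)
          (fun j => CatOver.fibHom
            ((CatOver.Hom.functor F).map (permutative (β (ρ j)) (ρs j) (x (ρ j))))) ≫
        permutative α ρ (fun j => CatOver.Hom.onFib F ⟨labelled (β j) (x j), rfl⟩) :=
  Labelled.Hom.ext' (fun _ => rfl) fun _ => heq_of_eq (Category.comp_id _).symm

/-- A morphism includes the equation `a = bρ`. Substituting it makes the source an operation of the
form `αρ`, after which the label morphisms and the permutation separate. This factorization is what
reduces functors on `TH` to products and symmetries. -/
theorem exists_hom {a b : T.Labelled H} (f : a ⟶ b) : ∃ (m : ℕ) (ρ : Fin m ≃ Fin b.arrow.arity)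
    (x : ∀ j, H.Fib (b.arrow.src (ρ j))) (g : x ⟶ fun j => b.label (ρ j))
    (h : a = labelled (T.act b.arrow.op ρ) x),
    f = eqToHom h ≫ levelwise (T.act b.arrow.op ρ) g ≫ permutative b.arrow.op ρ b.label := by
  obtain ⟨⟨n, c, i, α⟩, x⟩ := a
  obtain ⟨⟨ρ, h⟩, g⟩ := f
  dsimp only at ρ h g
  simp only [Arrow.act, Arrow.mk.injEq, true_and] at h
  obtain ⟨h₁, h₂, h₃⟩ := h
  subst h₁ h₂
  obtain rfl := eq_of_heq h₃
  refine ⟨n, ρ, x, fun j => CatOver.fibHom (g j), rfl, ?_⟩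
  refine Eq.trans ?_ (Category.id_comp _).symm
  exact Labelled.Hom.ext' (fun _ => rfl) fun _ => heq_of_eq (Category.comp_id _).symm

/-- The factorization is used for the outer operation and then for each label morphism, which is
itself a morphism of labelled operations. It splits naturality of the multiplication cell into two
squares. -/
theorem exists_hom₂ {n : ℕ} {c : Fin n → I} {i : I} (α : T.Op c i) {m : Fin n → ℕ}
    {d : ∀ j, Fin (m j) → I} (β : ∀ j, T.Op (d j) (c j)) (y : ∀ j k, H.Fib (d j k))
    {a : T.Labelled (T.label H)} (f : a ⟶ labelled₂ α β y) : ∃ (n' : ℕ) (ρ : Fin n' ≃ Fin n)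
    (m' : Fin n' → ℕ) (ρs : ∀ j, Fin (m' j) ≃ Fin (m (ρ j)))
    (x : ∀ j k, H.Fib (d (ρ j) (ρs j k))) (g : x ⟶ fun j k => y (ρ j) (ρs j k))
    (h : a = labelled₂ (T.act α ρ) (fun j => T.act (β (ρ j)) (ρs j)) x),
    f = eqToHom h ≫ levelwise₂ (T.act α ρ) (fun j => T.act (β (ρ j)) (ρs j)) g ≫
      permutative₂ α β ρ ρs y := by
  obtain ⟨n', ρ, x, g, rfl, rfl⟩ := exists_hom f
  obtain ⟨z, hz, rfl⟩ : ∃ (z : Fin n' → T.Labelled H)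
      (hz : ∀ j, (T.label H).proj.obj (z j) = ⟨c (ρ j)⟩), x = fun j => ⟨z j, hz j⟩ :=
    ⟨fun j => (x j).1, fun j => (x j).2, rfl⟩
  choose m' ρs x g' h h' using fun j => exists_hom (g j).1
  -- Replaces each inner source by its permuted form, so that all the `eqToHom`s of the inner
  -- factorizations are identities.
  obtain rfl : z = fun j => _ := funext h
  refine ⟨n', ρ, m', ρs, x, g', rfl, ?_⟩
  refine congrArg (_ ≫ ·) (Labelled.Hom.ext' (fun _ => rfl) fun j => heq_of_eq ?_)
  refine (Category.comp_id _).trans ((h' j).trans (Category.id_comp _))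

end Operad

/-! ### The symmetry axioms for the data of a lax algebra -/

namespace AlgebraData

open Operad Collection

variable {T : Operad I} {H : CatOver I} (A : AlgebraData T H)

/-- The first two axioms are the action applied to identities between permutative morphisms. The
third is naturality of `A.mult` at `permutative₂`, with its two sides computed by
`labelMap_permutative₂` and `multMap_permutative₂`. -/
theorem isSymmetric_toMorphismData : A.toMorphismData.IsSymmetric where
  symm_refl α x := Subtype.ext <|
    ((congrArg (CatOver.Hom.functor A.act).map (permutative_refl α x)).trans
      (eqToHom_map _ _)).trans (CatOver.fib_eqToHom_val
        (congrArg (fun β => A.actFib β x) (T.act_refl α))).symm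
  symm_trans α ρ τ x := Subtype.ext <|
    (congrArg (CatOver.Hom.functor A.act).map (permutative_trans α ρ τ x)).trans <|
      ((CatOver.Hom.functor A.act).map_comp _ _).trans <|
        congr (congrArg (· ≫ ·) ((eqToHom_map _ _).trans (CatOver.fib_eqToHom_val
          (congrArg (fun β => A.actFib β (fun j => x (ρ (τ j)))) (T.act_act α ρ τ).symm)).symm))
          ((CatOver.Hom.functor A.act).map_comp _ _)
  subst_symm α m d β ρ m' ρs x := Subtype.ext <| by
    have h := (CatOver.Hom₂.nat A.mult).naturality (permutative₂ α β ρ ρs x)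
    have h₁ : (T.labelMap A.act ≫ A.act).functor.map (permutative₂ α β ρ ρs x) = _ :=
      (congrArg (CatOver.Hom.functor A.act).map (labelMap_permutative₂ A.act α β ρ ρs x)).trans
        ((CatOver.Hom.functor A.act).map_comp _ _)
    have h₂ : (T.multHom H ≫ A.act).functor.map (permutative₂ α β ρ ρs x) = _ :=
      (congrArg (CatOver.Hom.functor A.act).map (multMap_permutative₂ α β ρ ρs x)).trans
        ((CatOver.Hom.functor A.act).map_comp _ _)
    refine (Category.assoc _ _ _).symm.trans
      ((congrArg (· ≫ _) h₁.symm).trans (h.trans (congrArg (_ ≫ ·) (h₂.trans ?_))))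
    exact congrArg (· ≫ _) ((eqToHom_map _ _).trans (CatOver.fib_eqToHom_val
      (obj_congr A.toMorphismData.prod (T.equivariance α β ρ ρs).symm _ _
        (flat_blockPerm ρ ρs x))).symm)

end AlgebraData

/-! ### From lax morphisms to lax algebras -/

namespace MorphismData

open Operad Collection

section

variable {T : Operad I} {H : CatOver I} (M : MorphismData T (fun i => H.Fib i))

/-- The action of a lax morphism on the objects of `TH`. -/
def actObj (a : T.Labelled H) : H.carrier := ((M.prod a.arrow.op).obj a.label).1

/-- The source of a morphism of labelled operations, as a labelling of the permuted operation. -/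
def srcLabel {a b : T.Labelled H} (f : a ⟶ b) (j : Fin a.arrow.arity) :
    H.Fib ((b.arrow.src ∘ Labelled.Hom.perm f) j) :=
  ⟨(a.label j).1, (a.label j).2.trans
    (congrArg Discrete.mk (Arrow.Hom.src_eq (Labelled.Hom.base f) j))⟩

theorem eq_labelled_srcLabel {a b : T.Labelled H} (f : a ⟶ b) :
    a = labelled (T.act b.arrow.op (Labelled.Hom.perm f)) (srcLabel f) := by
  refine Labelled.obj_ext (Arrow.Hom.eq_act (Labelled.Hom.base f)) fun j j' h => ?_
  obtain rfl := Fin.ext h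
  rfl

/-- The morphisms between labels, in the fibres. -/
def fibMap {a b : T.Labelled H} (f : a ⟶ b) :
    srcLabel f ⟶ fun j => b.label (Labelled.Hom.perm f j) :=
  fun j => CatOver.fibHom (Labelled.Hom.map f j)

/-- The action of a lax morphism on the morphisms of `TH`. -/
def actMap {a b : T.Labelled H} (f : a ⟶ b) : M.actObj a ⟶ M.actObj b :=
  eqToHom (congrArg M.actObj (eq_labelled_srcLabel f)) ≫
    ((M.prod (T.act b.arrow.op (Labelled.Hom.perm f))).map (fibMap f)).1 ≫
      ((M.symm b.arrow.op (Labelled.Hom.perm f)).app b.label).1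

/-- On a morphism already in factored form, the correcting `eqToHom` in `actMap` is an identity. By
`exists_hom` this formula covers all morphisms up to an equality of sources. -/
theorem actMap_comp_permutative {n m : ℕ} {c : Fin n → I} {i : I} (α : T.Op c i)
    (ρ : Fin m ≃ Fin n) {x : ∀ j, H.Fib (c (ρ j))} {y : ∀ j, H.Fib (c j)}
    (g : x ⟶ fun j => y (ρ j)) :
    M.actMap (levelwise (T.act α ρ) g ≫ permutative α ρ y) =
      ((M.prod (T.act α ρ)).map g).1 ≫ ((M.symm α ρ).app y).1 := by
  refine (Category.id_comp _).trans ?_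
  have h : fibMap (levelwise (T.act α ρ) g ≫ permutative α ρ y) = g :=
    funext fun j => Subtype.ext (Category.comp_id _)
  exact congrArg (fun g : x ⟶ fun j => y (ρ j) =>
    ((M.prod (T.act α ρ)).map g).1 ≫ ((M.symm α ρ).app y).1) h

theorem actMap_permutative {n m : ℕ} {c : Fin n → I} {i : I} (α : T.Op c i)
    (ρ : Fin m ≃ Fin n) (x : ∀ j, H.Fib (c j)) :
    M.actMap (permutative α ρ x) = ((M.symm α ρ).app x).1 := by
  have h := M.actMap_comp_permutative α ρ (y := x) (𝟙 (fun j => x (ρ j)))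
  rw [levelwise_id, Category.id_comp] at h
  refine h.trans ((congrArg (fun f => Subtype.val f ≫ _) ((M.prod (T.act α ρ)).map_id _)).trans ?_)
  exact Category.id_comp _

theorem prod_map_heq {n : ℕ} {c : Fin n → I} {i : I} {α α' : T.Op c i} (h : α = α')
    {x y : ∀ j, H.Fib (c j)} (f : x ⟶ y) : HEq ((M.prod α).map f).1 ((M.prod α').map f).1 := by
  subst h
  rfl

theorem actObj_congr {n : ℕ} {c : Fin n → I} {i : I} {α α' : T.Op c i} (h : α = α')
    (x : ∀ j, H.Fib (c j)) : ((M.prod α).obj x).1 = ((M.prod α').obj x).1 := by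
  subst h
  rfl

variable {M}

theorem symm_refl_heq (hM : M.IsSymmetric) {n : ℕ} {c : Fin n → I} {i : I} (α : T.Op c i)
    (x : ∀ j, H.Fib (c j)) : HEq ((M.symm α (Equiv.refl _)).app x).1 (𝟙 ((M.prod α).obj x).1) := by
  rw [hM.symm_refl]
  refine (heq_of_eq (CatOver.fib_eqToHom_val (congrArg (fun β => (M.prod β).obj x)
    (T.act_refl α)))).trans (eqToHom_heq_id_cod _ _ _)

/-- By definition `actMap` passes through `α1` and `ξ_{α,1}`, even for the trivial permutation; the
axiom `symm_refl` removes both. -/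
theorem actMap_levelwise (hM : M.IsSymmetric) {n : ℕ} {c : Fin n → I} {i : I} (α : T.Op c i)
    {x y : ∀ j, H.Fib (c j)}
    (f : x ⟶ y) : M.actMap (levelwise α f) = ((M.prod α).map f).1 := by
  refine eq_of_heq ((eqToHom_comp_heq _ _).trans ?_)
  have h₁ := M.actObj_congr (T.act_refl α)
  refine (comp_heq (h₁ x) (h₁ y) rfl (M.prod_map_heq (T.act_refl α) f)
    (symm_refl_heq hM α y)).trans (heq_of_eq (Category.comp_id _))

theorem actMap_id (hM : M.IsSymmetric) (a : T.Labelled H) : M.actMap (𝟙 a) = 𝟙 (M.actObj a) :=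
  (actMap_levelwise hM a.arrow.op (𝟙 a.label)).trans
    (congrArg Subtype.val ((M.prod a.arrow.op).map_id a.label))

theorem symm_trans_heq (hM : M.IsSymmetric) {n m l : ℕ} {c : Fin n → I} {i : I} (α : T.Op c i)
    (ρ : Fin m ≃ Fin n) (τ : Fin l ≃ Fin m) (x : ∀ j, H.Fib (c j)) :
    HEq ((M.symm α (τ.trans ρ)).app x).1
      (((M.symm (T.act α ρ) τ).app (fun j => x (ρ j))).1 ≫ ((M.symm α ρ).app x).1) := by
  refine (heq_of_eq (congrArg Subtype.val (hM.symm_trans α ρ τ x))).trans ?_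
  refine (heq_of_eq (congrArg (· ≫ _) (CatOver.fib_eqToHom_val (congrArg (fun β =>
    (M.prod β).obj (fun j => x (ρ (τ j)))) (T.act_act α ρ τ).symm)))).trans ?_
  exact eqToHom_comp_heq _ _

/-- With both factors in factored form, the composite has permutation `τ.trans ρ` and labels `f j ≫
g (τ j)`. The axiom `symm_trans` splits its symmetry, and naturality of `ξ_{γρ,τ}` exchanges that
symmetry with `g`. -/
theorem actMap_comp (hM : M.IsSymmetric) {a b c : T.Labelled H} (f : a ⟶ b) (g : b ⟶ c) :
    M.actMap (f ≫ g) = M.actMap f ≫ M.actMap g := by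
  obtain ⟨n, ρ, x, g, rfl, rfl⟩ := exists_hom g
  obtain ⟨m, τ, y, f, rfl, rfl⟩ := exists_hom f
  obtain ⟨⟨k, s, i, γ⟩, z⟩ := c
  simp only [eqToHom_refl, Category.id_comp]
  have e₁ := M.actMap_comp_permutative γ ρ g
  have e₂ := M.actMap_comp_permutative (T.act γ ρ) τ f
  refine Eq.trans ?_ (congr (congrArg (· ≫ ·) e₂) e₁).symm
  let g' : (fun j => x (τ j)) ⟶ fun j => z (ρ (τ j)) := fun j => g (τ j)
  let G : y ⟶ fun j => z (ρ (τ j)) := f ≫ g'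
  have h : fibMap ((levelwise (T.act (T.act γ ρ) τ) f ≫ permutative (T.act γ ρ) τ x) ≫
      levelwise (T.act γ ρ) g ≫ permutative γ ρ z) = G := by
    refine funext fun j => Subtype.ext ?_
    have h₁ : ((f j).1 ≫ 𝟙 _) ≫ (g (τ j)).1 ≫ 𝟙 _ = (f j).1 ≫ (g (τ j)).1 :=
      congr (congrArg CategoryStruct.comp (Category.comp_id (f j).1))
        (Category.comp_id (g (τ j)).1)
    exact h₁
  -- The composite is computed with `γ(ρτ)` and the two factors with `(γρ)τ`; this equality allows
  -- the comparison.
  have h₁ := M.actObj_congr (T.act_act γ ρ τ).symm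
  have h₂ : HEq (M.actMap ((levelwise (T.act (T.act γ ρ) τ) f ≫ permutative (T.act γ ρ) τ x) ≫
      levelwise (T.act γ ρ) g ≫ permutative γ ρ z))
      (((M.prod (T.act (T.act γ ρ) τ)).map G).1 ≫
        ((M.symm (T.act γ ρ) τ).app (fun j => z (ρ j))).1 ≫ ((M.symm γ ρ).app z).1) := by
    refine (eqToHom_comp_heq _ _).trans ?_
    refine comp_heq (h₁ _) (h₁ _) rfl ?_ (symm_trans_heq hM γ ρ τ z)
    refine HEq.trans ?_ (M.prod_map_heq (T.act_act γ ρ τ).symm G)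
    exact heq_of_eq (congrArg (fun G : y ⟶ fun j => z (ρ (τ j)) =>
      ((M.prod (T.act γ (τ.trans ρ))).map G).1) h)
  refine (eq_of_heq h₂).trans ?_
  have h₃ : ((M.prod (T.act (T.act γ ρ) τ)).map G).1 = _ :=
    congrArg Subtype.val ((M.prod (T.act (T.act γ ρ) τ)).map_comp f g')
  -- The exchange: `g` reindexed along `τ` is moved across `ξ_{γρ,τ}`.
  have h₄ : ((M.prod (T.act (T.act γ ρ) τ)).map g').1 ≫
      ((M.symm (T.act γ ρ) τ).app (fun j => z (ρ j))).1 = _ :=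
    congrArg Subtype.val ((M.symm (T.act γ ρ) τ).naturality g)
  refine (congrArg (· ≫ _) h₃).trans ?_
  refine (Category.assoc _ _ _).trans (Eq.trans ?_ (Category.assoc _ _ _).symm)
  refine congrArg (_ ≫ ·) ((Category.assoc _ _ _).symm.trans ?_)
  exact (congrArg (· ≫ _) h₄).trans (Category.assoc _ _ _)

/-- The action `TH ⟶ H` of a lax morphism. -/
def actHom (hM : M.IsSymmetric) : T.label H ⟶ H where
  functor :=
    { obj := M.actObj
      map := M.actMap
      map_id := actMap_id hM
      map_comp := actMap_comp hM }
  comm := CategoryTheory.Functor.ext (fun a => ((M.prod a.arrow.op).obj a.label).2)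
    fun _ _ _ => Subsingleton.elim _ _

theorem unit_app_heq {i : I} (x : H.Fib i) :
    HEq ((M.unit (H.colour x.1)).app (H.inFib x.1)).1 ((M.unit i).app x).1 := by
  obtain ⟨x, h⟩ := x
  obtain rfl : H.colour x = i := congrArg Discrete.as h
  rfl

/-- The unit coherence of a lax morphism. -/
def unitCell (hM : M.IsSymmetric) : 𝟙 H ⟶ T.unitHom H ≫ actHom hM :=
  CatOver.mk₂
    { app := fun x => ((M.unit (H.colour x)).app (H.inFib x)).1
      naturality := fun x y f => by
        -- As `I` is discrete, `f` forces `x` and `y` to have the same colour. Placing `x` in the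
        -- fibre of `y` makes `f` a morphism of one fibre, where naturality of `ν` applies.
        let x' : H.Fib (H.colour y) :=
          ⟨x, congrArg Discrete.mk (Discrete.eq_of_hom (H.proj.map f))⟩
        let f' : x' ⟶ H.inFib y := CatOver.fibHom f
        have h₁ : f ≫ ((M.unit (H.colour y)).app (H.inFib y)).1 =
            ((M.unit (H.colour y)).app x').1 ≫
              ((M.prod (T.one (H.colour y))).map (fun _ => f')).1 :=
          congrArg Subtype.val ((M.unit (H.colour y)).naturality f')
        have h₂ : HEq (M.actMap ((T.unitHom H).functor.map f))
            ((M.prod (T.one (H.colour y))).map (fun _ => f')).1 :=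
          (Functor.map_heq (CatOver.Hom.functor (actHom hM)) (unitHom_obj x') rfl
            (unitHom_map f')).trans (heq_of_eq (actMap_levelwise hM _ _))
        refine h₁.trans (eq_of_heq (comp_heq rfl ?_ rfl (unit_app_heq x').symm h₂.symm))
        exact (congrArg M.actObj (unitHom_obj x')).symm }

/-- The multiplication composes inner operations that are cast along equalities of targets, so its
component at a general object must compare their products with the uncast ones. -/
theorem prod_cast_obj {n : ℕ} {c : Fin n → I} {i i' : I} (h : i = i') (α : T.Op c i)
    (x : ∀ j, H.Fib (c j)) :
    ((M.prod (cast (congrArg (T.Op c) h) α)).obj x).1 = ((M.prod α).obj x).1 := by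
  subst h
  rfl

theorem multCell_source (hM : M.IsSymmetric) (a : T.Labelled (T.label H)) :
    (M.prod a.arrow.op).obj (T.labelMap (actHom hM) |>.functor.obj a).label =
      (M.prod a.arrow.op).obj (fun j =>
        (M.prod (cast (congrArg (T.Op (a.label j).1.arrow.src)
          (congrArg Discrete.as (a.label j).2)) (a.label j).1.arrow.op)).obj
            (a.label j).1.label) :=
  congrArg (M.prod a.arrow.op).obj <| funext fun j => Subtype.ext
    (prod_cast_obj (congrArg Discrete.as (a.label j).2) (a.label j).1.arrow.op
      (a.label j).1.label).symm

/-- The components of the multiplication coherence of a lax morphism. -/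
def multApp (hM : M.IsSymmetric) (a : T.Labelled (T.label H)) :
    (T.labelMap (actHom hM) ≫ actHom hM).functor.obj a ⟶
      (T.multHom H ≫ actHom hM).functor.obj a :=
  eqToHom (congrArg Subtype.val (multCell_source hM a)) ≫
    ((M.subst a.arrow.op fun j => cast (congrArg (T.Op (a.label j).1.arrow.src)
      (congrArg Discrete.as (a.label j).2)) (a.label j).1.arrow.op).app
        fun j => (a.label j).1.label).1

/-- On the normal form the casts are along `rfl`, so the correcting `eqToHom` is an identity. -/
theorem multApp_labelled₂ (hM : M.IsSymmetric) {n : ℕ} {c : Fin n → I} {i : I} (α : T.Op c i)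
    {m : Fin n → ℕ} {d : ∀ j, Fin (m j) → I} (β : ∀ j, T.Op (d j) (c j))
    (x : ∀ j k, H.Fib (d j k)) :
    multApp hM (labelled₂ α β x) = ((M.subst α β).app x).1 :=
  Category.id_comp _

/-- This square is naturality of `σ`, once `actMap_levelwise` has computed the action on both sides.
-/
theorem multApp_levelwise₂ (hM : M.IsSymmetric) {n : ℕ} {c : Fin n → I} {i : I} (α : T.Op c i)
    {m : Fin n → ℕ} {d : ∀ j, Fin (m j) → I} (β : ∀ j, T.Op (d j) (c j))
    {x y : ∀ j k, H.Fib (d j k)} (f : x ⟶ y) :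
    (T.labelMap (actHom hM) ≫ actHom hM).functor.map (levelwise₂ α β f) ≫
        multApp hM (labelled₂ α β y) =
      multApp hM (labelled₂ α β x) ≫
        (T.multHom H ≫ actHom hM).functor.map (levelwise₂ α β f) := by
  have h : ((M.prod α).map fun j => (M.prod (β j)).map (f j)).1 ≫ ((M.subst α β).app y).1 =
      ((M.subst α β).app x).1 ≫
        ((M.prod (T.comp α β)).map ((flat (fun i => H.Fib i) d).map f)).1 :=
    congrArg Subtype.val ((M.subst α β).naturality f)
  rw [multApp_labelled₂, multApp_labelled₂]
  have h₁ : (T.labelMap (actHom hM)).functor.map (levelwise₂ α β f) =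
      levelwise α fun j => (M.prod (β j)).map (f j) :=
    Labelled.Hom.ext' (fun _ => rfl) fun j => heq_of_eq (actMap_levelwise hM (β j) (f j))
  have h₂ : (T.labelMap (actHom hM) ≫ actHom hM).functor.map (levelwise₂ α β f) = _ :=
    (congrArg M.actMap h₁).trans (actMap_levelwise hM α _)
  have h₃ : (T.multHom H ≫ actHom hM).functor.map (levelwise₂ α β f) = _ :=
    (congrArg M.actMap (multMap_levelwise₂ α β f)).trans (actMap_levelwise hM (T.comp α β) _)
  exact (congrArg (· ≫ _) h₂).trans (h.trans (congrArg (_ ≫ ·) h₃.symm))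

/-- This square is the axiom `subst_symm`, and it is the only place where `multCell` needs that
axiom. -/
theorem multApp_permutative₂ (hM : M.IsSymmetric) {n n' : ℕ} {c : Fin n → I} {i : I}
    (α : T.Op c i) {m : Fin n → ℕ} {d : ∀ j, Fin (m j) → I} (β : ∀ j, T.Op (d j) (c j))
    (ρ : Fin n' ≃ Fin n) {m' : Fin n' → ℕ} (ρs : ∀ j, Fin (m' j) ≃ Fin (m (ρ j)))
    (x : ∀ j k, H.Fib (d j k)) :
    (T.labelMap (actHom hM) ≫ actHom hM).functor.map (permutative₂ α β ρ ρs x) ≫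
        multApp hM (labelled₂ α β x) =
      multApp hM (labelled₂ (T.act α ρ) (fun j => T.act (β (ρ j)) (ρs j)) fun j k =>
          x (ρ j) (ρs j k)) ≫
        (T.multHom H ≫ actHom hM).functor.map (permutative₂ α β ρ ρs x) := by
  have h := congrArg Subtype.val (hM.subst_symm α β ρ ρs x)
  rw [multApp_labelled₂, multApp_labelled₂]
  have h₁ : (T.labelMap (actHom hM)).functor.map (permutative₂ α β ρ ρs x) =
      levelwise (T.act α ρ) (fun j => (M.symm (β (ρ j)) (ρs j)).app (x (ρ j))) ≫
        permutative α ρ (fun j => (M.prod (β j)).obj (x j)) :=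
    Labelled.Hom.ext' (fun _ => rfl) fun j => heq_of_eq
      ((M.actMap_permutative (β (ρ j)) (ρs j) (x (ρ j))).trans (Category.comp_id _).symm)
  have h₂ : (T.labelMap (actHom hM) ≫ actHom hM).functor.map (permutative₂ α β ρ ρs x) = _ :=
    (congrArg M.actMap h₁).trans (M.actMap_comp_permutative α ρ _)
  have h₃ : (T.multHom H ≫ actHom hM).functor.map (permutative₂ α β ρ ρs x) = _ :=
    (congrArg (CatOver.Hom.functor (actHom hM)).map (multMap_permutative₂ α β ρ ρs x)).trans
      (((CatOver.Hom.functor (actHom hM)).map_comp _ _).trans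
        (congr (congrArg CategoryStruct.comp ((eqToHom_map _ _).trans (CatOver.fib_eqToHom_val
          (obj_congr M.prod (T.equivariance α β ρ ρs).symm _ _ (flat_blockPerm ρ ρs x))).symm))
          (M.actMap_permutative (T.comp α β) (blockPerm ρ ρs) _)))
  refine (congrArg (· ≫ _) h₂).trans ((Category.assoc _ _ _).trans (h.trans ?_))
  exact congrArg (_ ≫ ·) h₃.symm

/-- The multiplication coherence of a lax morphism. -/
def multCell (hM : M.IsSymmetric) :
    T.labelMap (actHom hM) ≫ actHom hM ⟶ T.multHom H ≫ actHom hM :=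
  CatOver.mk₂
    { app := multApp hM
      naturality := fun a b f => by
        -- Normal forms for the target and then for the morphism reduce naturality to pasting the
        -- levelwise square and the permutative square.
        obtain ⟨n, c, i, α, m, d, β, y, rfl⟩ := exists_labelled₂ b
        obtain ⟨n', ρ, m', ρs, x, g, rfl, rfl⟩ := exists_hom₂ α β y f
        have h₁ := multApp_levelwise₂ hM (T.act α ρ) (fun j => T.act (β (ρ j)) (ρs j)) g
        have h₂ := multApp_permutative₂ hM α β ρ ρs y
        simp only [eqToHom_refl, Category.id_comp, Functor.map_comp]
        refine (Category.assoc _ _ _).trans ((congrArg (_ ≫ ·) h₂).trans ?_)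
        refine (Category.assoc _ _ _).symm.trans ((congrArg (· ≫ _) h₁).trans ?_)
        exact Category.assoc _ _ _ }

/-- The data of a lax algebra given by the data of a lax morphism. -/
def toAlgebraData (hM : M.IsSymmetric) : AlgebraData T H where
  act := actHom hM
  unit := unitCell hM
  mult := multCell hM

end

/-! ### The two constructions are mutually inverse -/

/-- The types of the other fields depend on the products, so the products are identified before the
heterogeneous hypotheses become equalities. -/
theorem ext_of_heq {T : Operad I} {H : I → Type u} [∀ i, Category.{u} (H i)]
    {M M' : MorphismData T H}
    (obj : ∀ {n : ℕ} {c : Fin n → I} {i : I} (α : T.Op c i) (x : ∀ j, H (c j)),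
      (M.prod α).obj x = (M'.prod α).obj x)
    (map : ∀ {n : ℕ} {c : Fin n → I} {i : I} (α : T.Op c i) {x y : ∀ j, H (c j)} (f : x ⟶ y),
      HEq ((M.prod α).map f) ((M'.prod α).map f))
    (symm : ∀ {n m : ℕ} {c : Fin n → I} {i : I} (α : T.Op c i) (ρ : Fin m ≃ Fin n)
      (x : ∀ j, H (c j)), HEq ((M.symm α ρ).app x) ((M'.symm α ρ).app x))
    (unit : ∀ (i : I) (x : H i), HEq ((M.unit i).app x) ((M'.unit i).app x))
    (subst : ∀ {n : ℕ} {c : Fin n → I} {i : I} (α : T.Op c i) {m : Fin n → ℕ}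
      {d : ∀ j, Fin (m j) → I} (β : ∀ j, T.Op (d j) (c j)) (x : ∀ j k, H (d j k)),
      HEq ((M.subst α β).app x) ((M'.subst α β).app x)) : M = M' := by
  obtain ⟨p, s, v, t⟩ := M
  obtain ⟨p', s', v', t'⟩ := M'
  obtain rfl : @p = @p' := by
    funext n c i α
    exact CategoryTheory.Functor.hext (obj α) fun _ _ f => map α f
  obtain rfl : @s = @s' := by
    funext n m c i α ρ
    exact NatTrans.ext (funext fun x => eq_of_heq (symm α ρ x))
  obtain rfl : @v = @v' := funext fun i => NatTrans.ext (funext fun x => eq_of_heq (unit i x))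
  obtain rfl : @t = @t' := by
    funext n c i α m d β
    exact NatTrans.ext (funext fun x => eq_of_heq (subst α β x))
  rfl

variable {T : Operad I} {H : CatOver I} {M : MorphismData T (fun i => H.Fib i)}

/-- Only the symmetry axioms enter. The unit and associativity axioms can therefore be transferred
afterwards along this equality. -/
theorem toMorphismData_toAlgebraData (hM : M.IsSymmetric) :
    (toAlgebraData hM).toMorphismData = M := by
  refine ext_of_heq (fun _ _ => rfl) (fun α _ _ f => ?_) (fun α _ _ => ?_) (fun i x => ?_)
    fun α _ _ β x => ?_
  · exact heq_of_eq (Subtype.ext (actMap_levelwise hM α f))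
  · exact heq_of_eq (Subtype.ext (M.actMap_permutative α _ _))
  · refine heq_of_eq (Subtype.ext (eq_of_heq ((comp_eqToHom_heq _ _).trans (unit_app_heq x))))
  · exact heq_of_eq (Subtype.ext (multApp_labelled₂ hM α β x))

end MorphismData

namespace AlgebraData

open Operad Collection

variable {T : Operad I} {H : CatOver I}

/-- The products recover the action on objects and levelwise morphisms, the symmetries on
permutative ones, and `exists_hom` on the rest. The 2-cells are recovered from components, those of
`mult` by `exists_labelled₂`. -/
theorem toMorphismData_injective :
    Function.Injective (toMorphismData : AlgebraData T H → _) := by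
  rintro ⟨a, u, m⟩ ⟨a', u', m'⟩ h
  obtain rfl : a = a' := by
    refine CatOver.hom_ext (CategoryTheory.Functor.hext (fun b =>
      congrArg (fun M : MorphismData T (fun i => H.Fib i) =>
        ((M.prod b.arrow.op).obj b.label).1) h) fun b b' f => ?_)
    obtain ⟨n, ρ, x, g, rfl, rfl⟩ := exists_hom f
    have h₁ : HEq ((CatOver.Hom.functor a).map (levelwise (T.act b'.arrow.op ρ) g))
        ((CatOver.Hom.functor a').map (levelwise (T.act b'.arrow.op ρ) g)) :=
      congr_arg_heq (fun M : MorphismData T (fun i => H.Fib i) =>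
        ((M.prod (T.act b'.arrow.op ρ)).map g).1) h
    have h₂ : HEq ((CatOver.Hom.functor a).map (permutative b'.arrow.op ρ b'.label))
        ((CatOver.Hom.functor a').map (permutative b'.arrow.op ρ b'.label)) :=
      congr_arg_heq (fun M : MorphismData T (fun i => H.Fib i) =>
        ((M.symm b'.arrow.op ρ).app b'.label).1) h
    have h₃ : ∀ b : T.Labelled H, (CatOver.Hom.functor a).obj b = (CatOver.Hom.functor a').obj b :=
      fun b => congrArg (fun M : MorphismData T (fun i => H.Fib i) =>
        ((M.prod b.arrow.op).obj b.label).1) h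
    simp only [eqToHom_refl, Category.id_comp]
    refine (heq_of_eq ((CatOver.Hom.functor a).map_comp _ _)).trans
      ((comp_heq (h₃ _) (h₃ _) (h₃ _) h₁ h₂).trans
        (heq_of_eq ((CatOver.Hom.functor a').map_comp _ _).symm))
  obtain rfl : u = u' := by
    refine CatOver.hom₂_ext (NatTrans.ext (funext fun x => ?_))
    have h₁ := congr_arg_heq (fun M : MorphismData T (fun i => H.Fib i) =>
      ((M.unit (H.colour x)).app (H.inFib x)).1) h
    -- At `H.inFib x` the `eqToHom` in the definition of `ν` is an identity, so the component of the
    -- 2-cell is recovered exactly.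
    exact (Category.comp_id _).symm.trans ((eq_of_heq h₁).trans (Category.comp_id _))
  obtain rfl : m = m' := by
    refine CatOver.hom₂_ext (NatTrans.ext (funext fun b => ?_))
    obtain ⟨n, c, i, α, m, d, β, x, rfl⟩ := exists_labelled₂ b
    have h₁ := congr_arg_heq (fun M : MorphismData T (fun i => H.Fib i) =>
      ((M.subst α β).app x).1) h
    exact eq_of_heq h₁
  rfl

end AlgebraData

/-! ### Invertible and identity 2-cells, on components -/

/-- If all components are identities, naturality forces the two functors to agree on morphisms too,
hence to be equal. -/
theorem NatTrans.exists_eq_eqToHom_iff {C D : Type*} [Category C] [Category D] {F G : C ⥤ D}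
    (φ : F ⟶ G) : (∃ h, φ = eqToHom h) ↔ ∀ x, ∃ h, φ.app x = eqToHom h := by
  constructor
  · rintro ⟨rfl, rfl⟩ x
    exact ⟨rfl, rfl⟩
  · intro h
    choose h h' using h
    have hFG : F = G := CategoryTheory.Functor.ext h fun x y f => by
      have := φ.naturality f
      rw [h', h'] at this
      rw [← reassoc_of% this]
      simp
    exact ⟨hFG, NatTrans.ext (funext fun x => (h' x).trans (eqToHom_app hFG x).symm)⟩

theorem exists_comp_eqToHom_iff {C : Type*} [Category C] {x y z : C} (f : x ⟶ y) (h : y = z) :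
    (∃ k, f ≫ eqToHom h = eqToHom k) ↔ ∃ k, f = eqToHom k := by
  subst h
  simp

namespace CatOver

/-- The condition of lying over `I` is automatic for natural transformations, so an inverse
transformation is already an inverse 2-cell. -/
theorem isIso_iff {X Y : CatOver I} {F G : X ⟶ Y} (φ : F ⟶ G) :
    IsIso φ ↔ ∀ x, IsIso ((Hom₂.nat φ).app x) := by
  rw [← NatTrans.isIso_iff_isIso_app]
  constructor
  · rintro ⟨ψ, h₁, h₂⟩
    exact ⟨Hom₂.nat ψ, congrArg Hom₂.nat h₁, congrArg Hom₂.nat h₂⟩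
  · rintro ⟨ψ, h₁, h₂⟩
    exact ⟨mk₂ ψ, hom₂_ext h₁, hom₂_ext h₂⟩

theorem exists_eq_eqToHom_iff {X Y : CatOver I} {F G : X ⟶ Y} (φ : F ⟶ G) :
    (∃ h, φ = eqToHom h) ↔ ∀ x, ∃ h, (Hom₂.nat φ).app x = eqToHom h := by
  rw [← NatTrans.exists_eq_eqToHom_iff]
  constructor
  · rintro ⟨rfl, rfl⟩
    exact ⟨rfl, rfl⟩
  · rintro ⟨h, h'⟩
    exact ⟨hom_ext h, hom₂_ext (h'.trans (eqToHom_nat _).symm)⟩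

/-- Fibres over a discrete category are full, so an inverse in `H` lies in the fibre. -/
theorem fib_isIso_iff {X : CatOver I} {i : I} {x y : X.Fib i} (f : x ⟶ y) :
    IsIso f ↔ IsIso f.1 := by
  constructor
  · rintro ⟨g, h₁, h₂⟩
    exact ⟨g.1, congrArg Subtype.val h₁, congrArg Subtype.val h₂⟩
  · rintro ⟨g, h₁, h₂⟩
    exact ⟨fibHom g, Subtype.ext h₁, Subtype.ext h₂⟩

theorem fib_exists_eq_eqToHom_iff {X : CatOver I} {i : I} {x y : X.Fib i} (f : x ⟶ y) :
    (∃ h, f = eqToHom h) ↔ ∃ h, f.1 = eqToHom h := by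
  constructor
  · rintro ⟨rfl, rfl⟩
    exact ⟨rfl, rfl⟩
  · rintro ⟨h, h'⟩
    exact ⟨Subtype.ext h, Subtype.ext (h'.trans (fib_eqToHom_val (Subtype.ext h)).symm)⟩

end CatOver

open Operad Collection

variable {T : Operad I} {H : CatOver I}

namespace AlgebraData

variable (A : AlgebraData T H)

/-- A property of the components of the coherences of a lax algebra, up to identities, amounts to
the same property of the components of the units and the substitutions of the lax morphism. -/
theorem forall_unit_iff (P : ∀ {x y : H.carrier}, (x ⟶ y) → Prop)
    (hP : ∀ {x y z : H.carrier} (f : x ⟶ y) (h : y = z), P (f ≫ eqToHom h) ↔ P f) :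
    (∀ x, P ((CatOver.Hom₂.nat A.unit).app x)) ↔
      ∀ (i : I) (x : H.Fib i), P ((A.toMorphismData.unit i).app x).1 :=
  ⟨fun h _ x => (hP _ _).2 (h x.1), fun h x => (hP _ _).1 (h (H.colour x) (H.inFib x))⟩

/-- Stability of `P` under `eqToHom` plays no role, in contrast to the unit, because the
substitutions have literally the components of `mult`. -/
theorem forall_mult_iff (P : ∀ {x y : H.carrier}, (x ⟶ y) → Prop) :
    (∀ a, P ((CatOver.Hom₂.nat A.mult).app a)) ↔
      ∀ {n : ℕ} {c : Fin n → I} {i : I} (α : T.Op c i) {m : Fin n → ℕ}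
        {d : ∀ j, Fin (m j) → I} (β : ∀ j, T.Op (d j) (c j)) (x : ∀ j k, H.Fib (d j k)),
        P ((A.toMorphismData.subst α β).app x).1 := by
  refine ⟨fun h _ _ _ α _ _ β x => h (labelled₂ α β x), fun h a => ?_⟩
  obtain ⟨n, c, i, α, m, d, β, x, rfl⟩ := exists_labelled₂ a
  exact h α β x

end AlgebraData

/-! ### The correspondence -/

/-- Lax algebra structures on `H` correspond to lax morphism structures on the fibres of `H`. -/
noncomputable def laxEquiv (T : Operad I) (H : CatOver I) :
    LaxAlgebra T.twoMonad H ≃ LaxMorphism T (fun i => H.Fib i) where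
  toFun L := (AlgebraData.ofLaxAlgebra L).toMorphismData.toLaxMorphism
    (AlgebraData.isSymmetric_toMorphismData _)
    ((AlgebraData.isCoherent_iff_isLax _).2 (AlgebraData.isLax_ofLaxAlgebra L))
  invFun N := (MorphismData.toAlgebraData (MorphismData.isSymmetric_ofLaxMorphism N)).toLaxAlgebra
    ((AlgebraData.isCoherent_iff_isLax _).1 (by
      -- The algebra built from `N` has the morphism data of `N`, whose coherence is known; this
      -- gives the lax algebra axioms.
      rw [MorphismData.toMorphismData_toAlgebraData]
      exact MorphismData.isCoherent_ofLaxMorphism N))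
  left_inv L := by
    -- A section of an injective map is a two-sided inverse, so it suffices to compare morphism
    -- data.
    refine AlgebraData.ofLaxAlgebra_injective (AlgebraData.toMorphismData_injective ?_)
    exact MorphismData.toMorphismData_toAlgebraData _
  right_inv N := MorphismData.ofLaxMorphism_injective
    (MorphismData.toMorphismData_toAlgebraData (MorphismData.isSymmetric_ofLaxMorphism N))

/-- All clauses but the one for units hold by construction; the unit differs from `A.unit` by the
`eqToHom` between colours. -/
theorem corresponds_laxEquiv (L : LaxAlgebra T.twoMonad H) : Corresponds L (laxEquiv T H L) where
  prod_obj _ _ := rfl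
  prod_map _ _ _ _ := HEq.rfl
  symm _ _ _ := HEq.rfl
  unit _ := comp_eqToHom_heq _ _
  subst _ _ _ _ _ := HEq.rfl

theorem isPseudo_laxEquiv_iff (L : LaxAlgebra T.twoMonad H) :
    L.IsPseudo ↔ (laxEquiv T H L).IsPseudo := by
  let A := AlgebraData.ofLaxAlgebra L
  refine and_congr ?_ ?_
  · refine (CatOver.isIso_iff A.unit).trans ((A.forall_unit_iff IsIso fun _ h => ?_).trans ?_)
    · subst h
      simp
    · refine forall_congr' fun i => Iff.trans ?_ (NatTrans.isIso_iff_isIso_app _).symm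
      exact forall_congr' fun x => (CatOver.fib_isIso_iff _).symm
  · refine (CatOver.isIso_iff A.mult).trans ((A.forall_mult_iff IsIso).trans ?_)
    refine forall_congr' fun n => forall_congr' fun c => forall_congr' fun i =>
      forall_congr' fun α => forall_congr' fun m => forall_congr' fun d => forall_congr' fun β =>
        Iff.trans ?_ (NatTrans.isIso_iff_isIso_app _).symm
    exact forall_congr' fun x => (CatOver.fib_isIso_iff _).symm

theorem isStrict_laxEquiv_iff (L : LaxAlgebra T.twoMonad H) :
    L.IsStrict ↔ (laxEquiv T H L).IsStrict := by
  let A := AlgebraData.ofLaxAlgebra L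
  refine and_congr ?_ ?_
  · refine (CatOver.exists_eq_eqToHom_iff A.unit).trans
      ((A.forall_unit_iff (fun f => ∃ h, f = eqToHom h) exists_comp_eqToHom_iff).trans ?_)
    refine forall_congr' fun i => Iff.trans ?_ (NatTrans.exists_eq_eqToHom_iff _).symm
    exact forall_congr' fun x => (CatOver.fib_exists_eq_eqToHom_iff _).symm
  · refine (CatOver.exists_eq_eqToHom_iff A.mult).trans
      ((A.forall_mult_iff fun f => ∃ h, f = eqToHom h).trans ?_)
    refine forall_congr' fun n => forall_congr' fun c => forall_congr' fun i =>
      forall_congr' fun α => forall_congr' fun m => forall_congr' fun d => forall_congr' fun β =>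
        Iff.trans ?_ (NatTrans.exists_eq_eqToHom_iff _).symm
    exact forall_congr' fun x => (CatOver.fib_exists_eq_eqToHom_iff _).symm

end PolyOperad

theorem mainTheorem2 {I : Type u} (T : Operad I) (H : CatOver I) :
    ∃ e : LaxAlgebra T.twoMonad H ≃ LaxMorphism T H.Fib, ∀ A : LaxAlgebra T.twoMonad H,
      Operad.Corresponds A (e A) ∧
      (A.IsPseudo ↔ (e A).IsPseudo) ∧
      (A.IsStrict ↔ (e A).IsStrict) :=
  ⟨laxEquiv T H, fun A =>
    ⟨corresponds_laxEquiv A, isPseudo_laxEquiv_iff A, isStrict_laxEquiv_iff A⟩⟩
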